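/- **Restricted Monotonicity Principle.** Let $1<p<\infty$. A *regular domain* $\Omega$ is a bounded, connected, non-empty open subset of $\mathbb R^d$ whose boundary is split into a closed set $\partial\Omega_D\subset\partial\Omega$ and $\partial\Omega_N:=\partial\Omega\setminus\partial\Omega_D$, both of positive $(d-1)$-dimensional Hausdorff measure $\mathcal H^{d-1}$, such that near every point of $\partial\Omega_N$ the domain is, after a rotation, the strict epigraph of a continuous function (boundary of class $C$), and near $\mathcal H^{d-1}$-almost every point of $\partial\Omega_N$ this function can be taken to be $C^1$. Let $\nu$ be the outward unit normal of $\Omega$. Let $\mathcal D(\Omega,\partial\Omega_D)$ be the set of restrictions to $\Omega$ of the functions in $C_c^\infty(\mathbb R^d\setminus\partial\Omega_D)$, and $$\lambda_1(\Omega,\partial\Omega_D,p):=\inf\left\{\frac{\int_\Omega|\nabla\zeta|^p\,dx}{\int_\Omega|\zeta|^p\,dx}:\ \zeta\in\mathcal D(\Omega,\partial\Omega_D),\ \zeta\not\equiv0\text{ on }\Omega\right\}.$$ A *fundamental eigenfunction* of $(\Upsilon,\partial\Upsilon_D)$ is a function $u_1\neq0$ in the closure of $\mathcal D(\Upsilon,\partial\Upsilon_D)$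 in $W^{1,p}(\Upsilon)$ such that for all $\varphi\in\mathcal D(\Upsilon,\partial\Upsilon_D)$ $$\int_\Upsilon|\nabla u_1|^{p-2}\nabla u_1\cdot\nabla\varphi\,dx=\lambda_1(\Upsilon,\partial\Upsilon_D,p)\int_\Upsilon|u_1|^{p-2}u_1\varphi\,dx .$$ Let $\Omega\subset\Upsilon$ be regular domains, and let $u_1$ be a fundamental eigenfunction of $(\Upsilon,\partial\Upsilon_D)$ with $u_1>0$ almost everywhere on $\Omega$. Let $\Gamma\subset\partial\Omega_N$ be the set of all points of $\partial\Omega_N$ except those which have a neighbourhood $U$ with $U\cap\Omega=U\cap\Upsilon$ and $U\cap\partial\Upsilon_D=\emptyset$ (at the excepted points $\nu\cdot\nabla u_1=0$ holds in the weak sense, and nothing is assumed there). Suppose that: 1. $\nu\cdot\nabla u_1\ge0$ $\mathcal H^{d-1}$-a.e. on $\Gamma$, where the value of $\nabla u_1$ at a point of $\Gamma$ is its (essential) limit from inside $\Omega$, which is supposed to exist a.e. on $\Gamma$; 2. the set $B$ of the points of $\Gamma$ near which $\nabla u_1$ is not essentially bounded on $\Omega$ (which is empty, for instance, if $\nabla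 u_1$ extends continuously to $\Omega\cup\Gamma$) carries no flux: for every compact $K\subset B$ and every $\varepsilon>0$ there is $\chi\in C_c^\infty(\mathbb R^d)$ with $0\le\chi\le1$, $\chi=1$ near $K$, and $\int_\Omega\left(\chi+|\nabla u_1|^{p-1}|\nabla\chi|\right)dx<\varepsilon$. Then $$\lambda_1(\Omega,\partial\Omega_D,p)\ \ge\ \lambda_1(\Upsilon,\partial\Upsilon_D,p).$$ -/

import Mathlib

open MeasureTheory Filter Topology Set
open scoped ContDiff

namespace PLap

/-- Euclidean space of dimension `d`, with the Euclidean norm. -/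
abbrev E (d : ℕ) : Type := EuclideanSpace ℝ (Fin d)

/-- Near `x`, after a rotation, `Ω` is the strict epigraph of a `C^k` function `h` over a hyperplane
`e^⊥` (and hence the boundary of `Ω` is the graph of `h`); `y - ⟪e, y⟫ e` is the orthogonal
projection of `y` to this hyperplane. For `k = 0` this is a boundary of class `C` at `x`. -/
def BoundaryOfClassAt {d : ℕ} (k : ℕ∞) (Ω : Set (E d)) (x : E d) : Prop :=
  ∃ (e : E d) (h : E d → ℝ), ‖e‖ = 1 ∧ ContDiff ℝ k h ∧
    ∀ᶠ y in 𝓝 x, y ∈ Ω ↔ h (y - (inner ℝ e y) • e) < inner ℝ e y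

/-- `ν` is the outward unit normal of `Ω` at the boundary point `x`: in every cone around `-ν`
(resp. `ν`) with apex `x` that is smaller than a half space, all points close to `x` are inside
(resp. outside) `Ω`. Such a `ν` is unique. -/
def IsOutwardUnitNormal {d : ℕ} (Ω : Set (E d)) (x ν : E d) : Prop :=
  ‖ν‖ = 1 ∧ ∀ ε > 0, ∀ᶠ y in 𝓝 x,
    (inner ℝ ν (y - x) < -(ε * ‖y - x‖) → y ∈ Ω) ∧
    (ε * ‖y - x‖ < inner ℝ ν (y - x) → y ∉ Ω)

/-- A regular domain `Ω` whose boundary is split into a Dirichlet part `D` and the rest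
`frontier Ω \ D`, both of positive `(d-1)`-dimensional measure. The smoothness of the boundary is
only asked for outside `D`. -/
structure IsRegularDomain {d : ℕ} (Ω D : Set (E d)) : Prop where
  isOpen : IsOpen Ω
  isConnected : IsConnected Ω
  isBounded : Bornology.IsBounded Ω
  isClosed_dirichlet : IsClosed D
  dirichlet_subset : D ⊆ frontier Ω
  dirichlet_pos : 0 < μH[(d : ℝ) - 1] D
  rest_pos : 0 < μH[(d : ℝ) - 1] (frontier Ω \ D)
  classC : ∀ x ∈ frontier Ω \ D, BoundaryOfClassAt 0 Ω x
  ae_C1 : ∀ᵐ x ∂(μH[(d : ℝ) - 1] : Measure (E d)), x ∈ frontier Ω \ D → BoundaryOfClassAt 1 Ω x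

/-- The test functions: elements of `C_c^∞(ℝ^d \ D)` (they are only looked at on `Ω`). -/
structure IsTest {d : ℕ} (D : Set (E d)) (ζ : E d → ℝ) : Prop where
  smooth : ContDiff ℝ ∞ ζ
  compact : HasCompactSupport ζ
  away : Disjoint (tsupport ζ) D

/-- The fundamental eigenvalue `λ₁(Ω, D, p)` of the `p`-Laplacian: the infimum of the Rayleigh
quotient over the test functions that do not vanish identically on `Ω`. -/
noncomputable def lambda1 {d : ℕ} (Ω D : Set (E d)) (p : ℝ) : ℝ :=
  sInf {r : ℝ | ∃ ζ : E d → ℝ, IsTest D ζ ∧ (∃ x ∈ Ω, ζ x ≠ 0) ∧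
    r = (∫ x in Ω, ‖gradient ζ x‖ ^ p) / (∫ x in Ω, |ζ x| ^ p)}

/-- `u` belongs to the closure of the test functions in `W^{1,p}(Ω)`, and its weak gradient on `Ω`
is `Du`. -/
structure IsSobolev {d : ℕ} (Ω D : Set (E d)) (p : ℝ) (u : E d → ℝ) (Du : E d → E d) : Prop where
  memLp : MemLp u (ENNReal.ofReal p) (volume.restrict Ω)
  memLp_grad : MemLp Du (ENNReal.ofReal p) (volume.restrict Ω)
  approx : ∃ ζ : ℕ → E d → ℝ, (∀ n, IsTest D (ζ n)) ∧
    Tendsto (fun n => eLpNorm (fun x => ζ n x - u x) (ENNReal.ofReal p) (volume.restrict Ω))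
      atTop (𝓝 0) ∧
    Tendsto (fun n => eLpNorm (fun x => gradient (ζ n) x - Du x) (ENNReal.ofReal p)
      (volume.restrict Ω)) atTop (𝓝 0)

/-- `u`, with weak gradient `Du`, is a fundamental eigenfunction of the `p`-Laplacian with respect
to `(Ω, D)`: a nonzero weak solution of `-div(|∇u|^{p-2} ∇u) = λ₁ |u|^{p-2} u` in `Ω` with
Dirichlet condition on `D` and the natural condition on the rest of the boundary. -/
structure IsFundamentalEigenfunction {d : ℕ} (Ω D : Set (E d)) (p : ℝ) (u : E d → ℝ)
    (Du : E d → E d) : Prop where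
  sobolev : IsSobolev Ω D p u Du
  ne_zero : ¬ u =ᵐ[volume.restrict Ω] 0
  weak_eq : ∀ φ : E d → ℝ, IsTest D φ →
    ∫ x in Ω, ‖Du x‖ ^ (p - 2) * inner ℝ (Du x) (gradient φ x) =
      lambda1 Ω D p * ∫ x in Ω, |u x| ^ (p - 2) * u x * φ x

/-- The filter of points of `Ω` that are close to `x`, up to Lebesgue null sets: limits and bounds
along it are essential limits and bounds at `x` from inside `Ω`. -/
noncomputable def essNhds {d : ℕ} (Ω : Set (E d)) (x : E d) : Filter (E d) := 𝓝[Ω] x ⊓ ae volume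

/-- The points near which `Ω` coincides with `Υ` and that stay away from the Dirichlet part `DΥ` of
the boundary of `Υ`. At boundary points of this kind the natural boundary condition `ν · ∇u = 0` of
an eigenfunction `u` of `(Υ, DΥ)` holds in the weak sense. -/
def sharedNatural {d : ℕ} (Ω Υ DΥ : Set (E d)) : Set (E d) :=
  {x | ∃ U ∈ 𝓝 x, U ∩ Ω = U ∩ Υ ∧ Disjoint U DΥ}

/-- The field `|Du|^{p-2} Du` on `Ω` has no flux concentrated on `S`: the capacity of every compact
subset of `S`, with the weight `|Du|^{p-1}`, is zero. -/
def CarriesNoFlux {d : ℕ} (Ω : Set (E d)) (p : ℝ) (Du : E d → E d) (S : Set (E d)) : Prop :=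
  ∀ K ⊆ S, IsCompact K → ∀ ε > 0, ∃ χ : E d → ℝ,
    ContDiff ℝ ∞ χ ∧ HasCompactSupport χ ∧ (∀ x, 0 ≤ χ x ∧ χ x ≤ 1) ∧ (∀ᶠ y in 𝓝ˢ K, χ y = 1) ∧
    (∫ x in Ω, (χ x + ‖Du x‖ ^ (p - 1) * ‖gradient χ x‖)) < ε

/-- `ν · ∇u ≥ 0` almost everywhere on the part `N` of the boundary of `Ω`, with respect to surface
measure. The values of `Du = ∇u` on `N` are its essential limits from inside `Ω`. -/
def NormalDerivNonneg {d : ℕ} (Ω N : Set (E d)) (Du : E d → E d) : Prop :=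
  ∀ᵐ x ∂(μH[(d : ℝ) - 1] : Measure (E d)), x ∈ N →
    ∃ g : E d, Tendsto Du (essNhds Ω x) (𝓝 g) ∧
      ∀ ν : E d, IsOutwardUnitNormal Ω x ν → 0 ≤ inner ℝ ν g

/-- The points of `N` near which `Du` is not essentially bounded in `Ω`. -/
def unboundedPoints {d : ℕ} (Ω N : Set (E d)) (Du : E d → E d) : Set (E d) :=
  {x ∈ N | ¬ IsBoundedUnder (· ≤ ·) (essNhds Ω x) (fun y => ‖Du y‖)}

end PLap

/-!
The proof compares the Rayleigh quotient of a test function `ζ` of `(Ω, ΩD)` with the eigenfunction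
`u` of `Υ`. Picone's inequality says that `|∇u|^{p-2} ∇u · ∇(|ζ|^p / w^{p-1}) ≤ |∇ζ|^p` pointwise for
`w = u + ε`, and if `φ = |ζ|^p / w^{p-1}` may be used as a test function in
`∫_Ω |∇u|^{p-2} ∇u · ∇φ ≥ λ₁(Υ) ∫_Ω |u|^{p-2} u φ`, then `ε → 0` gives
`∫_Ω |∇ζ|^p ≥ λ₁(Υ) ∫_Ω |ζ|^p` (`integral_picone_le`, `mul_integral_le_integral_fderiv`).

What has to be shown is thus that the functional `flux`, which is `∫_Ω (F · ∇φ - f φ)` with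
`F = |∇u|^{p-2} ∇u` and `f = λ₁(Υ) |u|^{p-2} u`, is nonnegative on the nonnegative `C^1` functions `φ`
that vanish near `ΩD` (`IsFundamentalEigenfunction.flux_nonneg`). This avoids traces and the
divergence theorem, and rests on three facts.

* Nonnegativity is local (`flux_nonneg_of_fluxNonnegAt`), so the points where it fails form a closed
  set. The flux vanishes near the points of `Ω` and near the boundary points where `Ω` and `Υ` agree
  away from `ΥD`, by the weak equation on `Υ` (`IsFundamentalEigenfunction.flux_eq_zero`).
* If `Ω = {Φ > 0}` near a boundary point, and `F · ∇Φ ≤ 0` almost everywhere in `Ω` near it, then the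
  flux is nonnegative there (`fluxNonnegAt_of_defining_function`).
* A compact set that has cutoffs of small capacity, with weight `|F|`, is negligible
  (`flux_nonneg_of_removable`). By assumption this applies to the set where `∇u` is unbounded. Where
  `F` is bounded, it applies to compact sets of vanishing `(d-1)`-dimensional measure
  (`flux_nonneg_of_ae_fluxNonnegAt`).

For a fixed `C^1` chart with defining function `Φ`, and a constant field `e` with `e · ∇Φ = 1`,
the field `F - η e` satisfies `(F - η e) · ∇Φ ≤ 0` near almost every point of `Γ`, because the limit
of `F` there has a nonnegative component along the outward normal `-∇Φ / |∇Φ|`; off `Γ` it is enough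
that the fluxes of `F` and of `-e` are both nonnegative. The remaining points are relatively closed
and of measure zero, hence negligible, and `η → 0` (`flux_nonneg_of_chart`). The points of the
boundary without a `C^1` chart, and then those where `F` is unbounded, are removed in the same way
(`flux_nonneg_of_boundary`).
-/

namespace PLap

/-! ### Smoothing of `C^1` functions -/

/-- A compactly supported `C^1` function is the limit in `C^1` of smooth functions whose supports
shrink to its support: the convolutions with a bump function. -/
theorem exists_smooth_approx {d : ℕ} {φ : E d → ℝ} (hφ : ContDiff ℝ 1 φ)
    (hc : HasCompactSupport φ) {ε : ℝ} (hε : 0 < ε) :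
    ∃ ψ : E d → ℝ, ContDiff ℝ ∞ ψ ∧ HasCompactSupport ψ ∧
      tsupport ψ ⊆ Metric.cthickening ε (tsupport φ) ∧
      (∀ x, |ψ x - φ x| ≤ ε) ∧ ∀ x, ‖fderiv ℝ ψ x - fderiv ℝ φ x‖ ≤ ε := by
  have hdc : Continuous (fderiv ℝ φ) := hφ.continuous_fderiv one_ne_zero
  obtain ⟨δ₁, hδ₁, h₁⟩ := Metric.uniformContinuous_iff.1
    (hc.uniformContinuous_of_continuous hφ.continuous) ε hε
  obtain ⟨δ₂, hδ₂, h₂⟩ := Metric.uniformContinuous_iff.1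
    ((hc.fderiv ℝ).uniformContinuous_of_continuous hdc) ε hε
  set r := min ε (min δ₁ δ₂) with hr
  have hr0 : 0 < r := by positivity
  let b : ContDiffBump (0 : E d) := ⟨r / 2, r, by positivity, by linarith⟩
  have hbc : HasCompactSupport (b.normed volume) := b.hasCompactSupport_normed
  have hloc : LocallyIntegrable (b.normed (volume : Measure (E d))) volume :=
    b.continuous_normed.locallyIntegrable
  refine ⟨convolution (b.normed volume) φ (ContinuousLinearMap.lsmul ℝ ℝ) volume, ?_, ?_, ?_, ?_,
    ?_⟩
  · exact hbc.contDiff_convolution_left _ b.contDiff_normed hφ.continuous.locallyIntegrable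
  · exact hbc.convolution _ hc
  · have hs : Function.support (convolution (b.normed volume) φ (ContinuousLinearMap.lsmul ℝ ℝ)
        volume) ⊆ Metric.thickening ε (tsupport φ) := by
      intro x hx
      obtain ⟨y, hy, z, hz, rfl⟩ := Set.mem_add.1 (support_convolution_subset _ hx)
      rw [b.support_normed_eq, mem_ball_zero_iff] at hy
      refine Metric.mem_thickening_iff.2 ⟨z, subset_tsupport _ hz, ?_⟩
      rw [dist_eq_norm, add_sub_cancel_right]
      exact hy.trans_le (min_le_left _ _)
    exact closure_minimal (hs.trans (Metric.thickening_subset_cthickening _ _))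
      Metric.isClosed_cthickening
  · intro x
    rw [← Real.dist_eq]
    refine b.dist_normed_convolution_le hφ.continuous.aestronglyMeasurable fun y hy => ?_
    exact (h₁ ((Metric.mem_ball.1 hy).trans_le
      ((min_le_right _ _).trans (min_le_left _ _)))).le
  · intro x
    have hL : (ContinuousLinearMap.lsmul ℝ ℝ).precompR (E d) =
        (ContinuousLinearMap.lsmul ℝ ℝ : ℝ →L[ℝ] (E d →L[ℝ] ℝ) →L[ℝ] (E d →L[ℝ] ℝ)) := by
      ext a g
      simp [ContinuousLinearMap.precompR_apply]
    rw [(hc.hasFDerivAt_convolution_right (ContinuousLinearMap.lsmul ℝ ℝ) hloc hφ x).fderiv, hL,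
      ← dist_eq_norm]
    refine b.dist_normed_convolution_le hdc.aestronglyMeasurable fun y hy => ?_
    exact (h₂ ((Metric.mem_ball.1 hy).trans_le
      ((min_le_right _ _).trans (min_le_right _ _)))).le

/-! ### Cutoffs near compact sets of vanishing surface measure -/

/-- The covers in the definition of the Hausdorff measure may be replaced by finite covers with open
balls. Covering sets of diameter `0` also get a positive radius, as `r ↦ r ^ (d - 1)` is continuous. -/
theorem exists_ball_cover_of_hausdorffMeasure_eq_zero {d : ℕ} (hd : 0 < d) {K : Set (E d)}
    (hK : IsCompact K) (h0 : μH[(d : ℝ) - 1] K = 0) {c : ℝ} (hc : 0 < c) :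
    ∃ (s : Finset ℕ) (x : ℕ → E d) (ρ : ℕ → ℝ), (∀ n ∈ s, 0 < ρ n ∧ ρ n ≤ 1) ∧
      K ⊆ (⋃ n ∈ s, Metric.ball (x n) (ρ n)) ∧ ∑ n ∈ s, ρ n ^ (d - 1) ≤ c := by
  obtain ⟨k, rfl⟩ : ∃ k, d = k + 1 := ⟨d - 1, by omega⟩
  have hdk : (((k + 1 : ℕ) : ℝ) - 1) = (k : ℝ) := by push_cast; ring
  rw [hdk, Measure.hausdorffMeasure_apply] at h0
  have h1 := (le_iSup₂ (f := fun (r : ENNReal) (_ : 0 < r) =>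
        ⨅ (t : ℕ → Set (E (k + 1))) (_ : K ⊆ ⋃ n, t n) (_ : ∀ n, Metric.ediam (t n) ≤ r),
          ∑' n, ⨆ _ : (t n).Nonempty, Metric.ediam (t n) ^ (k : ℝ)) (2⁻¹ : ENNReal)
        (by norm_num)).trans h0.le
  have h2 : (⨅ (t : ℕ → Set (E (k + 1))) (_ : K ⊆ ⋃ n, t n)
      (_ : ∀ n, Metric.ediam (t n) ≤ (2⁻¹ : ENNReal)),
          ∑' n, ⨆ _ : (t n).Nonempty, Metric.ediam (t n) ^ (k : ℝ)) < ENNReal.ofReal (c / 2) :=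
    lt_of_le_of_lt h1 (by simpa using hc)
  simp only [iInf_lt_iff] at h2
  obtain ⟨t, hKt, hdiam, hsum⟩ := h2
  -- radii slightly larger than the diameters, with a summable error
  have hrad : ∀ n, ∃ ρ : ℝ, (Metric.ediam (t n)).toReal < ρ ∧ ρ ≤ 1 ∧
      ρ ^ k ≤ (Metric.ediam (t n)).toReal ^ k + c / 2 / 2 / 2 ^ n := by
    intro n
    set D := (Metric.ediam (t n)).toReal with hD
    have hD2 : D ≤ 1 / 2 := by
      have := ENNReal.toReal_mono (by norm_num) (hdiam n)
      simpa using this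
    have hcont : ∀ᶠ ρ in 𝓝[>] D, ρ ^ k < D ^ k + c / 2 / 2 / 2 ^ n := by
      have : Tendsto (fun ρ : ℝ => ρ ^ k) (𝓝[>] D) (𝓝 (D ^ k)) :=
        ((continuous_pow k).tendsto D).mono_left nhdsWithin_le_nhds
      exact this.eventually_lt_const (by linarith [show 0 < c / 2 / 2 / 2 ^ n by positivity])
    have hle : ∀ᶠ ρ in 𝓝[>] D, ρ < 1 :=
      nhdsWithin_le_nhds (eventually_lt_nhds (by linarith))
    obtain ⟨ρ, h1, h2, h3⟩ := (hcont.and (hle.and self_mem_nhdsWithin)).exists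
    exact ⟨ρ, h3, h2.le, h1.le⟩
  choose ρ hρ1 hρ2 hρ3 using hrad
  have hxe : ∀ n, ∃ x : E (k + 1), (t n).Nonempty → x ∈ t n := fun n => by
    by_cases h : (t n).Nonempty
    · exact ⟨h.some, fun _ => h.some_mem⟩
    · exact ⟨0, fun h' => absurd h' h⟩
  choose x hx using hxe
  have hρ0 : ∀ n, 0 < ρ n := fun n => ENNReal.toReal_nonneg.trans_lt (hρ1 n)
  have hfin : ∀ n, Metric.ediam (t n) ≠ ⊤ := fun n =>
    ((hdiam n).trans_lt (by norm_num)).ne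
  have hcov : K ⊆ ⋃ n ∈ {n | (t n).Nonempty}, Metric.ball (x n) (ρ n) := by
    intro y hy
    obtain ⟨n, hn⟩ := mem_iUnion.1 (hKt hy)
    have hne : (t n).Nonempty := ⟨y, hn⟩
    refine mem_iUnion₂.2 ⟨n, hne, ?_⟩
    have := Metric.edist_le_ediam_of_mem hn (hx n hne)
    rw [Metric.mem_ball, dist_edist]
    exact (ENNReal.toReal_mono (hfin n) this).trans_lt (hρ1 n)
  obtain ⟨b, hb, hbf, hbK⟩ := hK.elim_finite_subcover_image
    (fun n _ => Metric.isOpen_ball) hcov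
  refine ⟨hbf.toFinset, x, ρ, fun n _ => ⟨hρ0 n, hρ2 n⟩, by simpa using hbK, ?_⟩
  have hA : ∑ n ∈ hbf.toFinset, (Metric.ediam (t n)).toReal ^ k ≤ c / 2 := by
    have h3 : ∑ n ∈ hbf.toFinset, (Metric.ediam (t n)) ^ k ≤ ENNReal.ofReal (c / 2) := by
      refine le_trans ?_ ((ENNReal.sum_le_tsum hbf.toFinset).trans hsum.le)
      refine Finset.sum_le_sum fun n hn => ?_
      have hne : (t n).Nonempty := hb (hbf.mem_toFinset.1 hn)
      simp [hne]
    have h4 := ENNReal.toReal_mono ENNReal.ofReal_ne_top h3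
    rw [ENNReal.toReal_ofReal (by positivity), ENNReal.toReal_sum
      (fun n _ => ENNReal.pow_ne_top (hfin n))] at h4
    simpa using h4
  have hB : ∑ n ∈ hbf.toFinset, c / 2 / 2 / 2 ^ n ≤ c / 2 :=
    (summable_geometric_two' (c / 2)).sum_le_tsum _ (fun n _ => by positivity) |>.trans
      (tsum_geometric_two' (c / 2)).le
  calc ∑ n ∈ hbf.toFinset, ρ n ^ (k + 1 - 1)
      ≤ ∑ n ∈ hbf.toFinset, ((Metric.ediam (t n)).toReal ^ k + c / 2 / 2 / 2 ^ n) :=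
        Finset.sum_le_sum fun n _ => by simpa using hρ3 n
    _ ≤ c := by rw [Finset.sum_add_distrib]; linarith

/-- Compact sets of vanishing `(d-1)`-dimensional measure have vanishing `1`-capacity. -/
theorem exists_cutoff_of_hausdorffMeasure_eq_zero {d : ℕ} (hd : 0 < d) {K : Set (E d)}
    (hK : IsCompact K) (h0 : μH[(d : ℝ) - 1] K = 0) {ε : ℝ} (hε : 0 < ε) :
    ∃ χ : E d → ℝ, ContDiff ℝ 1 χ ∧ HasCompactSupport χ ∧ (∀ x, 0 ≤ χ x ∧ χ x ≤ 1) ∧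
      (∀ᶠ y in 𝓝ˢ K, χ y = 1) ∧ ∫ x, (χ x + ‖fderiv ℝ χ x‖) < ε := by
  let b : ContDiffBump (0 : E d) := ⟨1, 2, one_pos, one_lt_two⟩
  have hint : ∀ χ : E d → ℝ, ContDiff ℝ 1 χ → HasCompactSupport χ →
      Integrable (fun x => χ x + ‖fderiv ℝ χ x‖) := fun χ h1 h2 =>
    (h1.continuous.integrable_of_hasCompactSupport h2).add
      ((h1.continuous_fderiv one_ne_zero).integrable_of_hasCompactSupport (h2.fderiv ℝ)).norm
  have hb1 : ContDiff ℝ 1 b := b.contDiff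
  set C := ∫ x, (b x + ‖fderiv ℝ b x‖) with hC
  have hC0 : 0 ≤ C := integral_nonneg fun x => add_nonneg b.nonneg (norm_nonneg _)
  -- the rescaled bump function of a single ball
  have hsingle : ∀ (x : E d) (ρ : ℝ), 0 < ρ → ρ ≤ 1 → ∃ χ : E d → ℝ, ContDiff ℝ 1 χ ∧
      HasCompactSupport χ ∧ (∀ y, 0 ≤ χ y ∧ χ y ≤ 1) ∧ (∀ y ∈ Metric.ball x ρ, χ y = 1) ∧
      ∫ y, (χ y + ‖fderiv ℝ χ y‖) ≤ C * ρ ^ (d - 1) := by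
    intro x ρ hρ hρ1
    have hχc : ContDiff ℝ 1 (fun y : E d => b (ρ⁻¹ • (y - x))) := hb1.comp (by fun_prop)
    have hfd : ∀ y, ‖fderiv ℝ (fun y : E d => b (ρ⁻¹ • (y - x))) y‖ =
        ρ⁻¹ * ‖fderiv ℝ b (ρ⁻¹ • (y - x))‖ := by
      intro y
      have h1 : HasFDerivAt (fun y : E d => ρ⁻¹ • (y - x))
          (ρ⁻¹ • ContinuousLinearMap.id ℝ (E d)) y :=
        ((hasFDerivAt_id y).sub_const x).const_smul ρ⁻¹
      have h2 := ((hb1.differentiable one_ne_zero) (ρ⁻¹ • (y - x))).hasFDerivAt.comp y h1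
      have h3 : fderiv ℝ (fun y : E d => b (ρ⁻¹ • (y - x))) y =
          ρ⁻¹ • fderiv ℝ b (ρ⁻¹ • (y - x)) := by
        rw [show (fun y : E d => b (ρ⁻¹ • (y - x))) = b ∘ (fun y : E d => ρ⁻¹ • (y - x)) from rfl,
          h2.fderiv]
        ext v; simp
      rw [h3, norm_smul, Real.norm_of_nonneg (by positivity)]
    refine ⟨fun y => b (ρ⁻¹ • (y - x)), hχc, ?_, fun y => ⟨b.nonneg, b.le_one⟩, ?_, ?_⟩
    · refine HasCompactSupport.of_support_subset_isCompact
        (isCompact_closedBall x (2 * ρ)) fun y hy => ?_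
      have : ρ⁻¹ • (y - x) ∈ Function.support b := hy
      rw [b.support_eq, mem_ball_zero_iff, norm_smul, Real.norm_of_nonneg (by positivity)] at this
      rw [Metric.mem_closedBall, dist_eq_norm]
      have h2 : ρ⁻¹ * ‖y - x‖ < 2 := this
      rw [inv_mul_lt_iff₀ hρ] at h2
      linarith
    · intro y hy
      refine b.one_of_mem_closedBall ?_
      rw [mem_closedBall_zero_iff, norm_smul, Real.norm_of_nonneg (by positivity),
        inv_mul_le_iff₀ hρ]
      rw [Metric.mem_ball, dist_eq_norm] at hy
      change ‖y - x‖ ≤ ρ * 1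
      linarith
    · simp_rw [hfd]
      rw [integral_sub_right_eq_self (fun y => b (ρ⁻¹ • y) + ρ⁻¹ * ‖fderiv ℝ b (ρ⁻¹ • y)‖) x,
        Measure.integral_comp_inv_smul_of_nonneg volume
          (fun y => b y + ρ⁻¹ * ‖fderiv ℝ b y‖) hρ.le]
      have hbi : Integrable (fun y => b y) volume :=
        hb1.continuous.integrable_of_hasCompactSupport b.hasCompactSupport
      have hdi : Integrable (fun y => ‖fderiv ℝ b y‖) volume :=
        ((hb1.continuous_fderiv one_ne_zero).integrable_of_hasCompactSupport
          (b.hasCompactSupport.fderiv ℝ)).norm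
      have hle : ∫ y, (b y + ρ⁻¹ * ‖fderiv ℝ b y‖) ≤ ρ⁻¹ * C := by
        rw [hC, ← integral_const_mul]
        refine integral_mono (hbi.add (hdi.const_mul _)) ((hbi.add hdi).const_mul _) fun y => ?_
        have h1 : 1 ≤ ρ⁻¹ := (one_le_inv₀ hρ).2 hρ1
        have h2 : b y ≤ ρ⁻¹ * b y := le_mul_of_one_le_left b.nonneg h1
        simp only [mul_add]
        linarith
      rw [finrank_euclideanSpace_fin, smul_eq_mul]
      calc ρ ^ d * ∫ y, (b y + ρ⁻¹ * ‖fderiv ℝ b y‖) ≤ ρ ^ d * (ρ⁻¹ * C) := by gcongr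
        _ = C * ρ ^ (d - 1) := by
          obtain ⟨k, rfl⟩ : ∃ k, d = k + 1 := ⟨d - 1, by omega⟩
          simp only [add_tsub_cancel_right, pow_succ]
          field_simp
  obtain ⟨s, x, ρ, hρ, hcov, hsum⟩ := exists_ball_cover_of_hausdorffMeasure_eq_zero hd hK h0
    (c := ε / (2 * (C + 1))) (by positivity)
  have key : ∀ s : Finset ℕ, (∀ n ∈ s, 0 < ρ n ∧ ρ n ≤ 1) → ∃ χ : E d → ℝ, ContDiff ℝ 1 χ ∧
      HasCompactSupport χ ∧ (∀ y, 0 ≤ χ y ∧ χ y ≤ 1) ∧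
      (∀ n ∈ s, ∀ y ∈ Metric.ball (x n) (ρ n), χ y = 1) ∧
      ∫ y, (χ y + ‖fderiv ℝ χ y‖) ≤ C * ∑ n ∈ s, ρ n ^ (d - 1) := by
    intro s
    induction s using Finset.induction_on with
    | empty =>
      intro _
      exact ⟨fun _ => 0, contDiff_const, HasCompactSupport.zero, fun y => by simp, by simp,
        by simp⟩
    | insert n s hn ih =>
      intro hs
      obtain ⟨χ, h1, h2, h3, h4, h5⟩ := ih fun m hm => hs m (Finset.mem_insert_of_mem hm)
      obtain ⟨κ, g1, g2, g3, g4, g5⟩ := hsingle (x n) (ρ n)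
        (hs n (Finset.mem_insert_self _ _)).1 (hs n (Finset.mem_insert_self _ _)).2
      have hcd : ContDiff ℝ 1 (fun y => χ y + κ y * (1 - χ y)) :=
        h1.add (g1.mul (contDiff_const.sub h1))
      have hcs : HasCompactSupport (fun y => χ y + κ y * (1 - χ y)) :=
        h2.add (g2.mul_right (f' := fun y => 1 - χ y))
      refine ⟨fun y => χ y + κ y * (1 - χ y), hcd, hcs, fun y => ?_, ?_, ?_⟩
      · obtain ⟨a1, a2⟩ := h3 y
        obtain ⟨b1, b2⟩ := g3 y
        constructor <;> nlinarith [mul_nonneg b1 (sub_nonneg.2 a2),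
          mul_nonneg (sub_nonneg.2 b2) (sub_nonneg.2 a2)]
      · intro m hm y hy
        rcases Finset.mem_insert.1 hm with rfl | hm
        · simp [g4 y hy]
        · simp [h4 m hm y hy]
      · rw [Finset.sum_insert hn, mul_add]
        refine le_trans ?_ (add_le_add g5 h5)
        rw [← integral_add (hint κ g1 g2) (hint χ h1 h2)]
        refine integral_mono (hint _ hcd hcs) ((hint κ g1 g2).add (hint χ h1 h2)) fun y => ?_
        obtain ⟨a1, a2⟩ := h3 y
        obtain ⟨b1, b2⟩ := g3 y
        have hχ := ((h1.differentiable one_ne_zero) y).hasFDerivAt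
        have hκ := ((g1.differentiable one_ne_zero) y).hasFDerivAt
        have hd : fderiv ℝ (fun y => χ y + κ y * (1 - χ y)) y =
            (1 - κ y) • fderiv ℝ χ y + (1 - χ y) • fderiv ℝ κ y := by
          have h : HasFDerivAt (fun y => χ y + κ y * (1 - χ y)) _ y :=
            hχ.add (hκ.mul (hχ.const_sub 1))
          rw [h.fderiv]
          ext v
          simp
          ring
        have hn : ‖fderiv ℝ (fun y => χ y + κ y * (1 - χ y)) y‖ ≤
            ‖fderiv ℝ χ y‖ + ‖fderiv ℝ κ y‖ := by
          rw [hd]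
          refine (norm_add_le _ _).trans (add_le_add ?_ ?_) <;> rw [norm_smul] <;>
            refine mul_le_of_le_one_left (norm_nonneg _) ?_ <;>
            rw [Real.norm_eq_abs, abs_le] <;> constructor <;> linarith
        have : κ y * (1 - χ y) ≤ κ y := mul_le_of_le_one_right b1 (by linarith)
        simp only
        linarith
  obtain ⟨χ, h1, h2, h3, h4, h5⟩ := key s hρ
  refine ⟨χ, h1, h2, h3, ?_, lt_of_le_of_lt h5 ?_⟩
  · have hopen : IsOpen (⋃ n ∈ s, Metric.ball (x n) (ρ n)) :=
      isOpen_biUnion fun n _ => Metric.isOpen_ball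
    filter_upwards [(hopen.mem_nhdsSet).2 hcov] with y hy
    obtain ⟨n, hn, hy⟩ := mem_iUnion₂.1 hy
    exact h4 n hn y hy
  · calc C * ∑ n ∈ s, ρ n ^ (d - 1) ≤ C * (ε / (2 * (C + 1))) := by gcongr
      _ < ε := by
        rw [← mul_div_assoc, div_lt_iff₀ (by positivity)]
        nlinarith

/-! ### The flux functional -/

/-- The weak form of `-div F - f` on `Ω`, tested with `φ`. When `-div F = f` inside `Ω`, this is the
outward flux of `F` through the boundary of `Ω`, weighted with `φ`. -/
noncomputable def flux {d : ℕ} (Ω : Set (E d)) (F : E d → E d) (f φ : E d → ℝ) : ℝ :=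
  ∫ x in Ω, (fderiv ℝ φ x (F x) - f x * φ x)

/-- Nonnegative compactly supported `C^1` functions. -/
structure IsNonnegTest {d : ℕ} (φ : E d → ℝ) : Prop where
  contDiff : ContDiff ℝ 1 φ
  compact : HasCompactSupport φ
  nonneg : ∀ x, 0 ≤ φ x

/-- The flux is nonnegative on the nonnegative functions supported near `x`. -/
def FluxNonnegAt {d : ℕ} (Ω : Set (E d)) (F : E d → E d) (f : E d → ℝ) (x : E d) : Prop :=
  ∃ r > 0, ∀ φ, IsNonnegTest φ → tsupport φ ⊆ Metric.ball x r → 0 ≤ flux Ω F f φ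

section Flux

variable {d : ℕ} {Ω : Set (E d)} {F : E d → E d} {f φ ψ : E d → ℝ}

theorem exists_norm_fderiv_le (hφ : ContDiff ℝ 1 φ) (hc : HasCompactSupport φ) :
    ∃ C, 0 ≤ C ∧ ∀ x, ‖fderiv ℝ φ x‖ ≤ C := by
  obtain ⟨C, hC⟩ := (hc.fderiv ℝ).exists_bound_of_continuous
    (hφ.continuous_fderiv one_ne_zero)
  exact ⟨C, (norm_nonneg _).trans (hC 0), hC⟩

theorem integrableOn_fderiv_apply (hF : IntegrableOn F Ω) (hφ : ContDiff ℝ 1 φ)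
    (hc : HasCompactSupport φ) : IntegrableOn (fun x => fderiv ℝ φ x (F x)) Ω := by
  obtain ⟨C, _, hC⟩ := exists_norm_fderiv_le hφ hc
  refine Integrable.mono' (hF.norm.const_mul C) ?_ (ae_of_all _ fun x => ?_)
  · exact (ContinuousLinearMap.id ℝ (E d →L[ℝ] ℝ)).aestronglyMeasurable_comp₂
      (hφ.continuous_fderiv one_ne_zero).aestronglyMeasurable hF.aestronglyMeasurable
  · exact (ContinuousLinearMap.le_opNorm _ _).trans (by gcongr; exact hC x)

theorem integrableOn_mul_test (hf : IntegrableOn f Ω) (hφ : Continuous φ)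
    (hc : HasCompactSupport φ) : IntegrableOn (fun x => f x * φ x) Ω := by
  obtain ⟨C, hC⟩ := hc.exists_bound_of_continuous hφ
  exact hf.mul_bdd (c := C) hφ.aestronglyMeasurable (ae_of_all _ hC)

theorem integrableOn_flux (hF : IntegrableOn F Ω) (hf : IntegrableOn f Ω) (hφ : ContDiff ℝ 1 φ)
    (hc : HasCompactSupport φ) :
    IntegrableOn (fun x => fderiv ℝ φ x (F x) - f x * φ x) Ω :=
  (integrableOn_fderiv_apply hF hφ hc).sub (integrableOn_mul_test hf hφ.continuous hc)

theorem flux_add (hF : IntegrableOn F Ω) (hf : IntegrableOn f Ω) (hφ : ContDiff ℝ 1 φ)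
    (hc : HasCompactSupport φ) (hψ : ContDiff ℝ 1 ψ) (hc' : HasCompactSupport ψ) :
    flux Ω F f (fun x => φ x + ψ x) = flux Ω F f φ + flux Ω F f ψ := by
  rw [flux, flux, flux, ← integral_add (integrableOn_flux hF hf hφ hc)
    (integrableOn_flux hF hf hψ hc')]
  congr 1 with x
  rw [fderiv_fun_add ((hφ.differentiable one_ne_zero) x) ((hψ.differentiable one_ne_zero) x)]
  simp only [add_apply]
  ring

theorem flux_eq_mul_add_mul_one_sub (hF : IntegrableOn F Ω) (hf : IntegrableOn f Ω)
    (hφ : ContDiff ℝ 1 φ) (hc : HasCompactSupport φ) (hψ : ContDiff ℝ 1 ψ) :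
    flux Ω F f φ =
      flux Ω F f (fun x => φ x * ψ x) + flux Ω F f (fun x => φ x * (1 - ψ x)) := by
  rw [← flux_add hF hf (hφ.mul hψ) hc.mul_right (hφ.mul (contDiff_const.sub hψ)) hc.mul_right]
  congr 1
  ext x
  ring

theorem flux_zero : flux Ω F f (fun _ => 0) = 0 := by simp [flux]

theorem flux_integrand_eq_zero {x : E d} (hx : x ∉ tsupport φ) :
    fderiv ℝ φ x (F x) - f x * φ x = 0 := by
  rw [image_eq_zero_of_notMem_tsupport hx,
    Function.notMem_support.1 (fun h => hx (support_fderiv_subset ℝ h))]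
  simp

theorem flux_eq_zero_of_disjoint (h : Disjoint (tsupport φ) Ω) : flux Ω F f φ = 0 :=
  setIntegral_eq_zero_of_forall_eq_zero fun _ hx => flux_integrand_eq_zero (disjoint_right.1 h hx)

theorem flux_eq_of_subset {Υ : Set (E d)} (hΥ : MeasurableSet Υ) (hsub : Ω ⊆ Υ)
    (h : ∀ x ∈ Υ, x ∈ tsupport φ → x ∈ Ω) : flux Υ F f φ = flux Ω F f φ :=
  setIntegral_eq_of_subset_of_forall_sdiff_eq_zero hΥ hsub fun x hx =>
    flux_integrand_eq_zero fun hx' => hx.2 (h x hx.1 hx')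

theorem IsNonnegTest.mul (hφ : IsNonnegTest φ) (hψ : ContDiff ℝ 1 ψ) (h0 : ∀ x, 0 ≤ ψ x) :
    IsNonnegTest (fun x => φ x * ψ x) :=
  ⟨hφ.contDiff.mul hψ, hφ.compact.mul_right, fun x => mul_nonneg (hφ.nonneg x) (h0 x)⟩

theorem isOpen_setOf_fluxNonnegAt : IsOpen {x | FluxNonnegAt Ω F f x} := by
  rw [Metric.isOpen_iff]
  rintro x ⟨r, hr, h⟩
  refine ⟨r / 2, by positivity, fun y hy => ⟨r / 2, by positivity, fun φ hφ hs => h φ hφ ?_⟩⟩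
  refine hs.trans (Metric.ball_subset_ball' ?_)
  rw [Metric.mem_ball] at hy
  linarith

/-- Nonnegativity of the flux is a local property. -/
theorem flux_nonneg_of_fluxNonnegAt (hF : IntegrableOn F Ω) (hf : IntegrableOn f Ω)
    (hφ : IsNonnegTest φ) (h : ∀ x ∈ tsupport φ, FluxNonnegAt Ω F f x) :
    0 ≤ flux Ω F f φ := by
  choose! r hr hflux using h
  have hex : ∀ x, ∃ b : E d → ℝ, x ∈ tsupport φ → ContDiff ℝ 1 b ∧ (∀ y, 0 ≤ b y ∧ b y ≤ 1) ∧
      tsupport b ⊆ Metric.ball x (r x) ∧ ∀ᶠ y in 𝓝 x, b y = 1 := by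
    intro x
    by_cases hx : x ∈ tsupport φ
    · let b : ContDiffBump x := ⟨r x / 4, r x / 2, by linarith [hr x hx], by linarith [hr x hx]⟩
      refine ⟨b, fun _ => ⟨b.contDiff, fun y => ⟨b.nonneg, b.le_one⟩, ?_, b.eventuallyEq_one⟩⟩
      rw [b.tsupport_eq]
      exact Metric.closedBall_subset_ball (half_lt_self (hr x hx))
    · exact ⟨0, fun h => absurd h hx⟩
  choose b hb using hex
  -- subtracting finitely many localized pieces does not increase the flux
  have key : ∀ s : Finset (E d), (∀ x ∈ s, x ∈ tsupport φ) → ∃ ψ, IsNonnegTest ψ ∧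
      flux Ω F f ψ ≤ flux Ω F f φ ∧ (∀ y, φ y = 0 → ψ y = 0) ∧
      ∀ x ∈ s, ∀ y, b x y = 1 → ψ y = 0 := by
    intro s
    induction s using Finset.induction_on with
    | empty => exact fun _ => ⟨φ, hφ, le_rfl, fun _ h => h, by simp⟩
    | insert x s hx ih =>
      intro hs
      obtain ⟨ψ, h1, h2, h3, h4⟩ := ih fun y hy => hs y (Finset.mem_insert_of_mem hy)
      have hxs := hs x (Finset.mem_insert_self _ _)
      obtain ⟨b1, b2, b3, -⟩ := hb x hxs
      refine ⟨fun y => ψ y * (1 - b x y), h1.mul (contDiff_const.sub b1) fun y =>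
        sub_nonneg.2 (b2 y).2, ?_, fun y hy => by simp [h3 y hy], ?_⟩
      · rw [flux_eq_mul_add_mul_one_sub hF hf h1.contDiff h1.compact b1] at h2
        have := hflux x hxs _ (h1.mul b1 fun y => (b2 y).1)
          ((tsupport_mul_subset_right (f := ψ) (g := b x)).trans b3)
        linarith
      · intro z hz y hy
        rcases Finset.mem_insert.1 hz with rfl | hz
        · simp [hy]
        · simp [h4 z hz y hy]
  obtain ⟨t, ht, hcov⟩ := hφ.compact.isCompact.elim_nhds_subcover (fun x => {y | b x y = 1})
    fun x hx => (hb x hx).2.2.2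
  obtain ⟨ψ, h1, h2, h3, h4⟩ := key t ht
  have hψ : ψ = fun _ => 0 := by
    ext y
    by_cases hy : y ∈ tsupport φ
    · obtain ⟨x, hx, hxy⟩ := mem_iUnion₂.1 (hcov hy)
      exact h4 x hx y hxy
    · exact h3 y (image_eq_zero_of_notMem_tsupport hy)
  rw [hψ, flux_zero] at h2
  exact h2

/-! ### Removable sets -/

/-- An integrable function has small integral against weights in `[0, 1]` of small integral. -/
theorem exists_integral_mul_lt {α : Type*} [MeasurableSpace α] {μ : Measure α} {G : α → ℝ}
    (hG : Integrable G μ) {ε : ℝ} (hε : 0 < ε) :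
    ∃ δ > 0, ∀ χ : α → ℝ, Integrable χ μ → (∀ x, 0 ≤ χ x ∧ χ x ≤ 1) → ∫ x, χ x ∂μ < δ →
      ∫ x, G x * χ x ∂μ < ε := by
  have hlim : Tendsto (fun n : ℕ => ∫ x, max (G x - n) 0 ∂μ) atTop (𝓝 (∫ _, (0 : ℝ) ∂μ)) := by
    refine tendsto_integral_of_dominated_convergence (fun x => |G x|)
      (fun n => ?_) hG.abs (fun n => ae_of_all _ fun x => ?_) (ae_of_all _ fun x => ?_)
    · exact ((hG.aestronglyMeasurable.sub aestronglyMeasurable_const).sup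
        aestronglyMeasurable_const)
    · rw [Real.norm_of_nonneg (le_max_right _ _)]
      exact max_le (by linarith [le_abs_self (G x), (Nat.cast_nonneg n : (0 : ℝ) ≤ n)])
        (abs_nonneg _)
    · refine tendsto_const_nhds.congr' ?_
      obtain ⟨N, hN⟩ := exists_nat_ge (G x)
      filter_upwards [eventually_ge_atTop N] with n hn
      have : (N : ℝ) ≤ n := by exact_mod_cast hn
      rw [max_eq_right (by linarith)]
  rw [integral_zero] at hlim
  obtain ⟨n, hn⟩ := (hlim.eventually_lt_const (half_pos hε)).exists
  refine ⟨ε / 2 / (n + 1), by positivity, fun χ hχ h01 hlt => ?_⟩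
  have hmax : Integrable (fun x => max (G x - n) 0) μ := by
    refine Integrable.mono' hG.abs ((hG.aestronglyMeasurable.sub aestronglyMeasurable_const).sup
        aestronglyMeasurable_const) (ae_of_all _ fun x => ?_)
    rw [Real.norm_of_nonneg (le_max_right _ _)]
    exact max_le (by linarith [le_abs_self (G x), (Nat.cast_nonneg n : (0 : ℝ) ≤ n)])
        (abs_nonneg _)
  have hGχ : Integrable (fun x => G x * χ x) μ :=
    hG.mul_bdd (c := 1) hχ.aestronglyMeasurable (ae_of_all _ fun x => by
      rw [Real.norm_of_nonneg (h01 x).1]; exact (h01 x).2)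
  have hχ0 : 0 ≤ ∫ x, χ x ∂μ := integral_nonneg fun x => (h01 x).1
  calc ∫ x, G x * χ x ∂μ ≤ ∫ x, (n * χ x + max (G x - n) 0) ∂μ := by
        refine integral_mono hGχ ((hχ.const_mul _).add hmax) fun x => ?_
        obtain ⟨a, b⟩ := h01 x
        have h1 := le_max_left (G x - n) 0
        have h2 := le_max_right (G x - n) 0
        simp only
        nlinarith
    _ = n * ∫ x, χ x ∂μ + ∫ x, max (G x - n) 0 ∂μ := by
        rw [integral_add (hχ.const_mul _) hmax, integral_const_mul]
    _ < ε := by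
        have h1 : (n + 1) * ∫ x, χ x ∂μ < ε / 2 := by
          rw [lt_div_iff₀ (by positivity)] at hlt
          linarith
        nlinarith

/-- A compact set with cutoffs of arbitrarily small weighted capacity is negligible for the flux. -/
theorem flux_nonneg_of_removable (hΩ : MeasurableSet Ω) (hF : IntegrableOn F Ω)
    (hf : IntegrableOn f Ω) (hφ : IsNonnegTest φ) {K : Set (E d)}
    (hK : ∀ ε > 0, ∃ χ : E d → ℝ, ContDiff ℝ 1 χ ∧ HasCompactSupport χ ∧
      (∀ x, 0 ≤ χ x ∧ χ x ≤ 1) ∧ (∀ᶠ y in 𝓝ˢ K, χ y = 1) ∧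
      ∫ x in Ω ∩ tsupport φ, (χ x + ‖F x‖ * ‖fderiv ℝ χ x‖) < ε)
    (h : ∀ x ∈ tsupport φ, x ∉ K → FluxNonnegAt Ω F f x) :
    0 ≤ flux Ω F f φ := by
  obtain ⟨C, hC0, hC⟩ := exists_norm_fderiv_le hφ.contDiff hφ.compact
  obtain ⟨M, hM⟩ := hφ.compact.exists_bound_of_continuous hφ.contDiff.continuous
  have hM0 : 0 ≤ M := (norm_nonneg _).trans (hM 0)
  set S := tsupport φ with hS
  have hΩS : MeasurableSet (Ω ∩ S) := hΩ.inter (isClosed_tsupport φ).measurableSet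
  have hF' : IntegrableOn F (Ω ∩ S) := hF.mono_set inter_subset_left
  have hf' : IntegrableOn f (Ω ∩ S) := hf.mono_set inter_subset_left
  have hG : Integrable (fun x => C * ‖F x‖ + M * ‖f x‖) (volume.restrict (Ω ∩ S)) :=
    (hF'.norm.const_mul C).add (hf'.norm.const_mul M)
  refine le_of_forall_pos_lt_add fun ε hε => ?_
  obtain ⟨δ, hδ, hδG⟩ := exists_integral_mul_lt hG (half_pos hε)
  obtain ⟨χ, c1, c2, c3, c4, c5⟩ := hK (min δ (ε / 2 / (M + 1))) (by positivity)
  rw [flux_eq_mul_add_mul_one_sub hF hf hφ.contDiff hφ.compact c1]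
  have hnn : 0 ≤ flux Ω F f (fun x => φ x * (1 - χ x)) := by
    refine flux_nonneg_of_fluxNonnegAt hF hf (hφ.mul (contDiff_const.sub c1) fun y =>
      sub_nonneg.2 (c3 y).2) fun x hx => h x (tsupport_mul_subset_left hx) fun hxK => ?_
    have h1 : (fun y => φ y * (1 - χ y)) =ᶠ[𝓝 x] 0 := by
      filter_upwards [(eventually_nhdsSet_iff_forall.1 c4) x hxK] with y hy
      simp [hy]
    exact (notMem_tsupport_iff_eventuallyEq.2 h1) hx
  have hχi : Integrable χ (volume.restrict (Ω ∩ S)) :=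
    (c1.continuous.integrable_of_hasCompactSupport c2).integrableOn
  obtain ⟨C', -, hC'⟩ := exists_norm_fderiv_le c1 c2
  have hdi : Integrable (fun x => ‖F x‖ * ‖fderiv ℝ χ x‖) (volume.restrict (Ω ∩ S)) :=
    hF'.norm.mul_bdd (c := C') (c1.continuous_fderiv one_ne_zero).norm.aestronglyMeasurable
      (ae_of_all _ fun x => by rw [norm_norm]; exact hC' x)
  rw [integral_add hχi hdi] at c5
  have i1 : 0 ≤ ∫ x in Ω ∩ S, χ x := integral_nonneg fun x => (c3 x).1
  have i2 : 0 ≤ ∫ x in Ω ∩ S, ‖F x‖ * ‖fderiv ℝ χ x‖ := integral_nonneg fun x => by positivity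
  have hsmall1 := hδG χ hχi c3 (by linarith [min_le_left δ (ε / 2 / (M + 1))])
  have hsmall2 : M * ∫ x in Ω ∩ S, ‖F x‖ * ‖fderiv ℝ χ x‖ < ε / 2 := by
    have h1 : (∫ x in Ω ∩ S, ‖F x‖ * ‖fderiv ℝ χ x‖) < ε / 2 / (M + 1) := by
      linarith [min_le_right δ (ε / 2 / (M + 1))]
    rw [lt_div_iff₀ (by positivity)] at h1
    nlinarith
  have hGχ : Integrable (fun x => (C * ‖F x‖ + M * ‖f x‖) * χ x) (volume.restrict (Ω ∩ S)) :=
    hG.mul_bdd (c := 1) hχi.aestronglyMeasurable (ae_of_all _ fun x => by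
      rw [Real.norm_of_nonneg (c3 x).1]; exact (c3 x).2)
  have hbound : -flux Ω F f (fun x => φ x * χ x) ≤
      ∫ x in Ω ∩ S, ((C * ‖F x‖ + M * ‖f x‖) * χ x + M * (‖F x‖ * ‖fderiv ℝ χ x‖)) := by
    have hrestr : flux Ω F f (fun x => φ x * χ x) = flux (Ω ∩ S) F f (fun x => φ x * χ x) :=
      flux_eq_of_subset hΩ inter_subset_left fun x hx hx' => ⟨hx, tsupport_mul_subset_left hx'⟩
    rw [hrestr, flux, ← integral_neg]
    refine integral_mono (integrableOn_flux hF' hf' (hφ.contDiff.mul c1) hφ.compact.mul_right).neg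
      (hGχ.add (hdi.const_mul M)) fun x => ?_
    have hd : fderiv ℝ (fun x => φ x * χ x) x (F x) =
        φ x * fderiv ℝ χ x (F x) + χ x * fderiv ℝ φ x (F x) := by
      rw [fderiv_fun_mul ((hφ.contDiff.differentiable one_ne_zero) x)
        ((c1.differentiable one_ne_zero) x)]
      simp
    simp only [hd]
    have e1 : -(φ x * fderiv ℝ χ x (F x)) ≤ M * (‖F x‖ * ‖fderiv ℝ χ x‖) := by
      refine (neg_le_abs _).trans ?_
      rw [abs_mul]
      refine mul_le_mul (hM x) ?_ (abs_nonneg _) hM0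
      rw [mul_comm ‖F x‖]
      exact (fderiv ℝ χ x).le_opNorm (F x)
    have e2 : -(χ x * fderiv ℝ φ x (F x)) ≤ C * ‖F x‖ * χ x := by
      rw [mul_comm (χ x), ← neg_mul]
      refine mul_le_mul_of_nonneg_right ((neg_le_abs _).trans ?_) (c3 x).1
      exact ((fderiv ℝ φ x).le_opNorm (F x)).trans (by gcongr; exact hC x)
    have e3 : f x * (φ x * χ x) ≤ M * ‖f x‖ * χ x := by
      rw [← mul_assoc, mul_comm M]
      refine mul_le_mul_of_nonneg_right ((le_abs_self _).trans ?_) (c3 x).1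
      rw [abs_mul]
      exact mul_le_mul_of_nonneg_left (hM x) (abs_nonneg _)
    linarith
  rw [integral_add hGχ (hdi.const_mul M), integral_const_mul] at hbound
  linarith

/-- Where `F` is bounded, it suffices to know the sign of the flux almost everywhere with respect to
the surface measure: the points where it is unknown form a relatively closed set, and this has
vanishing `1`-capacity. -/
theorem flux_nonneg_of_ae_fluxNonnegAt (hd : 0 < d) (hΩ : MeasurableSet Ω) (hF : IntegrableOn F Ω)
    (hf : IntegrableOn f Ω) (hφ : IsNonnegTest φ) {M : ℝ}
    (hM : ∀ᵐ x ∂volume.restrict Ω, x ∈ tsupport φ → ‖F x‖ ≤ M)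
    (h : ∀ᵐ x ∂(μH[(d : ℝ) - 1] : Measure (E d)), x ∈ tsupport φ → FluxNonnegAt Ω F f x) :
    0 ≤ flux Ω F f φ := by
  set K := tsupport φ ∩ {x | FluxNonnegAt Ω F f x}ᶜ with hKdef
  have hK : IsCompact K :=
    hφ.compact.isCompact.inter_right isOpen_setOf_fluxNonnegAt.isClosed_compl
  have hK0 : μH[(d : ℝ) - 1] K = 0 := by
    refine measure_mono_null ?_ (ae_iff.1 h)
    intro x hx
    exact fun h => hx.2 (h hx.1)
  have hM' : ∀ᵐ x ∂volume.restrict (Ω ∩ tsupport φ), ‖F x‖ ≤ |M| := by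
    rw [inter_comm, ← Measure.restrict_restrict (isClosed_tsupport φ).measurableSet,
      ae_restrict_iff' (isClosed_tsupport φ).measurableSet]
    filter_upwards [hM] with x hx h
    exact (hx h).trans (le_abs_self _)
  refine flux_nonneg_of_removable hΩ hF hf hφ (K := K) (fun ε hε => ?_) fun x hx hxK => ?_
  · obtain ⟨χ, c1, c2, c3, c4, c5⟩ := exists_cutoff_of_hausdorffMeasure_eq_zero hd hK hK0
      (ε := ε / (|M| + 1)) (by positivity)
    refine ⟨χ, c1, c2, c3, c4, ?_⟩
    have hχi := c1.continuous.integrable_of_hasCompactSupport (μ := volume) c2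
    have hdi := ((c1.continuous_fderiv one_ne_zero).integrable_of_hasCompactSupport
      (μ := volume) (c2.fderiv ℝ)).norm
    rw [lt_div_iff₀ (by positivity)] at c5
    refine lt_of_le_of_lt ?_ c5
    calc ∫ x in Ω ∩ tsupport φ, (χ x + ‖F x‖ * ‖fderiv ℝ χ x‖)
        ≤ ∫ x in Ω ∩ tsupport φ, (χ x + ‖fderiv ℝ χ x‖) * (|M| + 1) := by
          refine integral_mono_of_nonneg (ae_of_all _ fun x => add_nonneg (c3 x).1 (by positivity))
            ((hχi.add hdi).mul_const _).integrableOn ?_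
          filter_upwards [hM'] with x hx
          have := mul_le_mul_of_nonneg_right hx (norm_nonneg (fderiv ℝ χ x))
          nlinarith [(c3 x).1, abs_nonneg M, norm_nonneg (fderiv ℝ χ x),
            mul_nonneg (c3 x).1 (abs_nonneg M)]
      _ ≤ ∫ x, (χ x + ‖fderiv ℝ χ x‖) * (|M| + 1) :=
          setIntegral_le_integral ((hχi.add hdi).mul_const _) (ae_of_all _ fun x =>
            mul_nonneg (add_nonneg (c3 x).1 (norm_nonneg _)) (by positivity))
      _ = _ := by rw [integral_mul_const]
  · by_contra hn
    exact hxK ⟨hx, hn⟩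

end Flux

/-! ### The flux through a `C^1` part of the boundary -/

section Chart

variable {d : ℕ} {Ω : Set (E d)} {F : E d → E d} {f φ ψ Φ : E d → ℝ}

/-- If `Ω = {Φ > 0}` near `x` and `F · ∇Φ ≤ 0` in `Ω` near `x`, then the flux is nonnegative at `x`:
test the equation with `φ θ(nΦ)`, where `θ` is an increasing cutoff that vanishes near `0`. -/
theorem fluxNonnegAt_of_defining_function (hΩ : MeasurableSet Ω) (hF : IntegrableOn F Ω)
    (hf : IntegrableOn f Ω) (hΦ : ContDiff ℝ 1 Φ) {x : E d} {r : ℝ} (hr : 0 < r)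
    (hchart : ∀ y ∈ Metric.ball x r, y ∈ Ω ↔ 0 < Φ y)
    (hzero : ∀ ψ : E d → ℝ, ContDiff ℝ 1 ψ → HasCompactSupport ψ → tsupport ψ ⊆ Ω →
      flux Ω F f ψ = 0)
    (hle : ∀ᵐ y ∂volume.restrict Ω, y ∈ Metric.ball x r → fderiv ℝ Φ y (F y) ≤ 0) :
    FluxNonnegAt Ω F f x := by
  refine ⟨r, hr, fun φ hφ hs => ?_⟩
  set θ : ℝ → ℝ := fun s => Real.smoothTransition (s - 1) with hθ
  have hθc : ContDiff ℝ 1 θ := Real.smoothTransition.contDiff.comp (contDiff_id.sub contDiff_const)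
  have hθm : Monotone θ := fun a b hab => Real.smoothTransition.monotone (by linarith)
  have hθ01 : ∀ s, 0 ≤ θ s ∧ θ s ≤ 1 := fun s =>
    ⟨Real.smoothTransition.nonneg _, Real.smoothTransition.le_one _⟩
  have hηc : ∀ n : ℕ, ContDiff ℝ 1 (fun y => θ (n * Φ y)) := fun n =>
    hθc.comp (contDiff_const.mul hΦ)
  have hz : ∀ n : ℕ, flux Ω F f (fun y => φ y * θ (n * Φ y)) = 0 := by
    intro n
    refine hzero _ (hφ.contDiff.mul (hηc n)) hφ.compact.mul_right ?_
    have hcl : IsClosed (tsupport φ ∩ {y | 1 ≤ n * Φ y}) :=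
      (isClosed_tsupport φ).inter
        (isClosed_le continuous_const (continuous_const.mul hΦ.continuous))
    have hsub : tsupport (fun y => φ y * θ (n * Φ y)) ⊆ tsupport φ ∩ {y | 1 ≤ n * Φ y} := by
      refine closure_minimal (fun y hy => ⟨?_, ?_⟩) hcl
      · exact subset_tsupport _ (left_ne_zero_of_mul hy)
      · by_contra hlt
        refine right_ne_zero_of_mul hy (Real.smoothTransition.zero_of_nonpos ?_)
        have : (n : ℝ) * Φ y < 1 := not_le.1 hlt
        linarith
    intro y hy
    obtain ⟨hy1, hy2⟩ := hsub hy
    rw [hchart y (hs hy1)]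
    by_contra hn
    have h1 : (1 : ℝ) ≤ n * Φ y := hy2
    nlinarith [(Nat.cast_nonneg n : (0 : ℝ) ≤ n), not_lt.1 hn]
  have hint := integrableOn_flux hF hf hφ.contDiff hφ.compact
  have hintη : ∀ n : ℕ, IntegrableOn
      (fun y => (fderiv ℝ φ y (F y) - f y * φ y) * θ (n * Φ y)) Ω := fun n =>
    hint.mul_bdd (c := 1) (hηc n).continuous.aestronglyMeasurable (ae_of_all _ fun y => by
      rw [Real.norm_of_nonneg (hθ01 _).1]; exact (hθ01 _).2)
  have hlim : Tendsto (fun n : ℕ => ∫ y in Ω, (fderiv ℝ φ y (F y) - f y * φ y) * θ (n * Φ y))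
      atTop (𝓝 (flux Ω F f φ)) := by
    refine tendsto_integral_of_dominated_convergence
      (fun y => ‖fderiv ℝ φ y (F y) - f y * φ y‖) (fun n => (hintη n).aestronglyMeasurable)
      hint.norm (fun n => ae_of_all _ fun y => ?_) ?_
    · rw [norm_mul, Real.norm_of_nonneg (hθ01 _).1]
      exact mul_le_of_le_one_right (norm_nonneg _) (hθ01 _).2
    · refine (ae_restrict_iff' hΩ).2 (ae_of_all _ fun y hy => ?_)
      by_cases hyφ : y ∈ tsupport φ
      · have hpos : 0 < Φ y := (hchart y (hs hyφ)).1 hy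
        refine tendsto_const_nhds.congr' ?_
        obtain ⟨N, hN⟩ := exists_nat_gt (2 / Φ y)
        filter_upwards [eventually_ge_atTop N] with n hn
        have h1 : 2 / Φ y < n := hN.trans_le (by exact_mod_cast hn)
        rw [div_lt_iff₀ hpos] at h1
        rw [hθ]
        simp only
        rw [Real.smoothTransition.one_of_one_le (by linarith), mul_one]
      · simp [flux_integrand_eq_zero hyφ]
  refine ge_of_tendsto' hlim fun n => ?_
  rw [← hz n]
  refine integral_mono_ae (integrableOn_flux hF hf (hφ.contDiff.mul (hηc n))
    hφ.compact.mul_right) (hintη n) ?_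
  filter_upwards [hle] with y hy
  have hdθ : HasFDerivAt (fun y => θ (n * Φ y)) _ y :=
    ((hθc.differentiable one_ne_zero) _).hasDerivAt.comp_hasFDerivAt y
      (((hΦ.differentiable one_ne_zero) y).hasFDerivAt.const_mul (n : ℝ))
  have hd : fderiv ℝ (fun y => φ y * θ (n * Φ y)) y (F y) =
      φ y * (deriv θ (n * Φ y) * (n * fderiv ℝ Φ y (F y))) +
        θ (n * Φ y) * fderiv ℝ φ y (F y) := by
    rw [fderiv_fun_mul ((hφ.contDiff.differentiable one_ne_zero) y) hdθ.differentiableAt,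
      hdθ.fderiv]
    simp
  have hneg : φ y * (deriv θ (n * Φ y) * (n * fderiv ℝ Φ y (F y))) ≤ 0 := by
    by_cases hyφ : y ∈ tsupport φ
    · exact mul_nonpos_of_nonneg_of_nonpos (hφ.nonneg y)
        (mul_nonpos_of_nonneg_of_nonpos hθm.deriv_nonneg
          (mul_nonpos_of_nonneg_of_nonpos n.cast_nonneg (hy (hs hyφ))))
    · simp [image_eq_zero_of_notMem_tsupport hyφ]
  simp only [hd]
  linarith

theorem integral_fderiv_apply_eq_zero (hψ : ContDiff ℝ 1 ψ) (hc : HasCompactSupport ψ) (v : E d) :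
    ∫ x, fderiv ℝ ψ x v = 0 := by
  have h := integral_mul_fderiv_eq_neg_fderiv_mul_of_integrable (μ := (volume : Measure (E d)))
    (f := fun _ : E d => (1 : ℝ)) (g := ψ) (v := v) (by simp)
    (by simpa using ((hψ.continuous_fderiv one_ne_zero).clm_apply
      continuous_const).integrable_of_hasCompactSupport (hc.fderiv_apply ℝ v))
    (by simpa using hψ.continuous.integrable_of_hasCompactSupport hc)
    (fun x _ => differentiableAt_const _) (fun x _ => (hψ.differentiable one_ne_zero) x)
  simpa using h

theorem flux_add_smul (hF : IntegrableOn F Ω) (hf : IntegrableOn f Ω) {G : E d → E d}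
    (hG : IntegrableOn G Ω) (hφ : ContDiff ℝ 1 φ) (hc : HasCompactSupport φ) (η : ℝ) :
    flux Ω (fun y => F y + η • G y) f φ = flux Ω F f φ + η * flux Ω G 0 φ := by
  rw [flux, flux, flux, ← integral_const_mul, ← integral_add (integrableOn_flux hF hf hφ hc)
    ((integrableOn_flux hG (integrable_zero _ _ _) hφ hc).const_mul η)]
  congr 1 with x
  simp
  ring

/-- The condition `F · ∇Φ ≤ 0` is only needed in the limit, and only at almost every boundary point
with respect to the surface measure. The proof replaces `F` by `F - η e`, where `e` is a
constant field with `e · ∇Φ = 1`: this turns `F · ∇Φ < η` into `F · ∇Φ < 0`, does not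
change the divergence, and costs a multiple of `η`. -/
theorem flux_nonneg_of_chart (hd : 0 < d) (hΩ : MeasurableSet Ω) (hΩb : volume Ω ≠ ⊤)
    (hF : IntegrableOn F Ω) (hf : IntegrableOn f Ω) (hΦ : ContDiff ℝ 1 Φ) {e : E d}
    (he : ∀ y, fderiv ℝ Φ y e = 1) {V : Set (E d)} (hV : IsOpen V)
    (hchart : ∀ y ∈ V, y ∈ Ω ↔ 0 < Φ y)
    (hzero : ∀ ψ : E d → ℝ, ContDiff ℝ 1 ψ → HasCompactSupport ψ → tsupport ψ ⊆ Ω →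
      flux Ω F f ψ = 0) {M : ℝ} (hM : ∀ᵐ y ∂volume.restrict Ω, y ∈ V → ‖F y‖ ≤ M)
    (hae : ∀ᵐ y ∂(μH[(d : ℝ) - 1] : Measure (E d)), y ∈ V → FluxNonnegAt Ω F f y ∨
      ∀ η > 0, ∃ r > 0, ∀ᵐ z ∂volume.restrict Ω, z ∈ Metric.ball y r →
        fderiv ℝ Φ z (F z) ≤ η)
    (hφ : IsNonnegTest φ) (hs : tsupport φ ⊆ V) : 0 ≤ flux Ω F f φ := by
  have hc : IntegrableOn (fun _ : E d => -e) Ω := integrableOn_const hΩb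
  have hzero' : ∀ ψ : E d → ℝ, ContDiff ℝ 1 ψ → HasCompactSupport ψ → tsupport ψ ⊆ Ω →
      flux Ω (fun _ => -e) 0 ψ = 0 := by
    intro ψ h1 h2 h3
    rw [← flux_eq_of_subset MeasurableSet.univ (subset_univ Ω) fun x _ hx => h3 hx]
    simpa [flux] using integral_fderiv_apply_eq_zero h1 h2 (-e)
  have hball : ∀ y ∈ V, ∃ r > 0, Metric.ball y r ⊆ V := fun y hy => Metric.isOpen_iff.1 hV y hy
  -- the constant field `-e` points out of `Ω` everywhere in the chart
  have hnn' : ∀ y ∈ V, FluxNonnegAt Ω (fun _ => -e) 0 y := by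
    intro y hy
    obtain ⟨r, hr, hrV⟩ := hball y hy
    refine fluxNonnegAt_of_defining_function hΩ hc (integrable_zero _ _ _) hΦ hr
      (fun z hz => hchart z (hrV hz)) hzero' (ae_of_all _ fun z _ => ?_)
    rw [map_neg, he]
    norm_num
  have key : ∀ η > 0, 0 ≤ flux Ω F f φ + η * flux Ω (fun _ => -e) 0 φ := by
    intro η hη
    rw [← flux_add_smul hF hf hc hφ.contDiff hφ.compact]
    have hFη : IntegrableOn (fun y => F y + η • -e) Ω := hF.add (hc.smul η)
    refine flux_nonneg_of_ae_fluxNonnegAt hd hΩ hFη hf hφ (M := M + ‖η • -e‖) ?_ ?_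
    · filter_upwards [hM] with y hy hyφ
      exact (norm_add_le _ _).trans (by gcongr; exact hy (hs hyφ))
    · filter_upwards [hae] with y hy hyφ
      rcases hy (hs hyφ) with ⟨r, hr, h⟩ | h
      · obtain ⟨r', hr', h'⟩ := hnn' y (hs hyφ)
        refine ⟨min r r', by positivity, fun ψ hψ hψs => ?_⟩
        rw [flux_add_smul hF hf hc hψ.contDiff hψ.compact]
        exact add_nonneg (h ψ hψ (hψs.trans (Metric.ball_subset_ball (min_le_left _ _))))
          (mul_nonneg hη.le
            (h' ψ hψ (hψs.trans (Metric.ball_subset_ball (min_le_right _ _)))))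
      · obtain ⟨r, hr, hle⟩ := h η hη
        obtain ⟨r', hr', hrV⟩ := hball y (hs hyφ)
        refine fluxNonnegAt_of_defining_function hΩ hFη hf hΦ (r := min r r') (by positivity)
          (fun z hz => hchart z (hrV (Metric.ball_subset_ball (min_le_right _ _) hz)))
          (fun ψ h1 h2 h3 => ?_) ?_
        · rw [flux_add_smul hF hf hc h1 h2, hzero ψ h1 h2 h3, hzero' ψ h1 h2 h3]
          simp
        · filter_upwards [hle] with z hz hzr
          have := hz (Metric.ball_subset_ball (min_le_left _ _) hzr)
          rw [map_add, map_smul, map_neg, he]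
          simp only [smul_eq_mul]
          linarith
  have hlim : Tendsto (fun η : ℝ => flux Ω F f φ + η * flux Ω (fun _ => -e) 0 φ) (𝓝[>] 0)
      (𝓝 (flux Ω F f φ + 0 * flux Ω (fun _ => -e) 0 φ)) :=
    ((continuous_const.add (continuous_id.mul continuous_const)).tendsto 0).mono_left
      nhdsWithin_le_nhds
  rw [zero_mul, add_zero] at hlim
  exact ge_of_tendsto hlim (eventually_nhdsWithin_of_forall fun η hη => key η hη)

end Chart

/-! ### Charts and normals -/

/-- A `C^1` boundary has a global defining function that is linear in the direction `e`. -/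
theorem BoundaryOfClassAt.exists_defining_function {d : ℕ} {Ω : Set (E d)} {x : E d}
    (h : BoundaryOfClassAt 1 Ω x) : ∃ (e : E d) (Φ : E d → ℝ), ContDiff ℝ 1 Φ ∧
      (∀ y, fderiv ℝ Φ y e = 1) ∧ ∀ᶠ y in 𝓝 x, y ∈ Ω ↔ 0 < Φ y := by
  obtain ⟨e, h, he, hh, hx⟩ := h
  have hΦ : ContDiff ℝ 1 (fun y : E d => inner ℝ e y - h (y - (inner ℝ e y) • e)) := by
    have h1 : ContDiff ℝ 1 (fun y : E d => (inner ℝ e y : ℝ)) := contDiff_const.inner ℝ contDiff_id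
    exact h1.sub (ContDiff.comp (by exact_mod_cast hh) (contDiff_id.sub (h1.smul contDiff_const)))
  refine ⟨e, _, hΦ, fun y => ?_, by simpa only [sub_pos] using hx⟩
  rw [← ((hΦ.differentiable one_ne_zero) y).lineDeriv_eq_fderiv, lineDeriv]
  have hee : (inner ℝ e e : ℝ) = 1 := by rw [real_inner_self_eq_norm_sq, he]; norm_num
  have : ∀ t : ℝ, (inner ℝ e (y + t • e) - h (y + t • e - (inner ℝ e (y + t • e) : ℝ) • e) : ℝ) =
      t + (inner ℝ e y - h (y - (inner ℝ e y : ℝ) • e)) := by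
    intro t
    rw [inner_add_right, inner_smul_right, hee, add_smul]
    rw [show y + t • e - ((inner ℝ e y : ℝ) • e + (t * 1) • e) = y - (inner ℝ e y : ℝ) • e by
      rw [mul_one]; abel]
    ring
  simp_rw [this]
  simp

theorem isOutwardUnitNormal_of_defining_function {d : ℕ} {Ω : Set (E d)} {x : E d}
    {Φ : E d → ℝ} (hΦ : DifferentiableAt ℝ Φ x) (h0 : Φ x = 0) (hne : gradient Φ x ≠ 0)
    (hx : ∀ᶠ y in 𝓝 x, y ∈ Ω ↔ 0 < Φ y) :
    IsOutwardUnitNormal Ω x (-(‖gradient Φ x‖⁻¹ • gradient Φ x)) := by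
  have hpos : 0 < ‖gradient Φ x‖ := norm_pos_iff.2 hne
  refine ⟨by rw [norm_neg, norm_smul, norm_inv, norm_norm, inv_mul_cancel₀ hpos.ne'], ?_⟩
  intro ε hε
  have hO := (hasGradientAt_iff_isLittleO.1 hΦ.hasGradientAt).def
    (c := ε * ‖gradient Φ x‖) (by positivity)
  filter_upwards [hx, hO] with y hy hyO
  rw [h0, sub_zero, Real.norm_eq_abs, abs_le] at hyO
  have hin : (inner ℝ (-(‖gradient Φ x‖⁻¹ • gradient Φ x)) (y - x) : ℝ) =
      -(‖gradient Φ x‖⁻¹ * inner ℝ (gradient Φ x) (y - x)) := by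
    rw [inner_neg_left, real_inner_smul_left]
  rw [hin, hy]
  have hmul : ‖gradient Φ x‖ * (‖gradient Φ x‖⁻¹ * inner ℝ (gradient Φ x) (y - x)) =
      inner ℝ (gradient Φ x) (y - x) := by
    rw [← mul_assoc, mul_inv_cancel₀ hpos.ne', one_mul]
  constructor
  · intro h
    have h1 := mul_lt_mul_of_pos_left (neg_lt_neg_iff.1 h) hpos
    rw [hmul] at h1
    nlinarith [hyO.1]
  · intro h
    have h1 := mul_lt_mul_of_pos_left h hpos
    rw [mul_neg, hmul] at h1
    nlinarith [hyO.2]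

/-! ### Nonnegativity of the flux -/

theorem inner_gradient {d : ℕ} (φ : E d → ℝ) (x v : E d) :
    inner ℝ (gradient φ x) v = fderiv ℝ φ x v := by
  simp [gradient]

theorem norm_gradient {d : ℕ} (φ : E d → ℝ) (x : E d) : ‖gradient φ x‖ = ‖fderiv ℝ φ x‖ := by
  simp [gradient]

theorem eventually_essNhds_iff {d : ℕ} {Ω : Set (E d)} (hΩ : MeasurableSet Ω) {x : E d}
    {P : E d → Prop} : (∀ᶠ y in essNhds Ω x, P y) ↔
      ∃ r > 0, ∀ᵐ y ∂volume.restrict Ω, y ∈ Metric.ball x r → P y := by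
  have h : essNhds Ω x = 𝓝 x ⊓ ae (volume.restrict Ω) := by
    rw [essNhds, nhdsWithin, ae_restrict_eq hΩ, inf_assoc, inf_comm (𝓟 Ω)]
  rw [h, Filter.Eventually, mem_inf_iff_superset]
  constructor
  · rintro ⟨s, hs, t, ht, hst⟩
    obtain ⟨r, hr, hrs⟩ := Metric.mem_nhds_iff.1 hs
    refine ⟨r, hr, ?_⟩
    filter_upwards [ht] with y hy hyr
    exact hst ⟨hrs hyr, hy⟩
  · rintro ⟨r, hr, h⟩
    exact ⟨_, Metric.ball_mem_nhds x hr, _, h, fun y hy => hy.2 hy.1⟩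

theorem eq_zero_of_mem_frontier_of_chart {d : ℕ} {Ω V : Set (E d)} (hΩ : IsOpen Ω)
    (hV : IsOpen V) {Φ : E d → ℝ} (hΦ : Continuous Φ) (hchart : ∀ y ∈ V, y ∈ Ω ↔ 0 < Φ y)
    {y : E d} (hy : y ∈ V) (hyf : y ∈ frontier Ω) : Φ y = 0 := by
  rw [hΩ.frontier_eq] at hyf
  refine le_antisymm (not_lt.1 fun h => hyf.2 ((hchart y hy).2 h)) (not_lt.1 fun h => ?_)
  obtain ⟨z, ⟨hz1, hz2⟩, hz3⟩ := mem_closure_iff.1 hyf.1 (V ∩ {z | Φ z < 0})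
    (hV.inter (isOpen_lt hΦ continuous_const)) ⟨hy, h⟩
  exact lt_asymm hz2 ((hchart z hz1).1 hz3)

section Boundary

variable {d : ℕ} {Ω Γ : Set (E d)} {F : E d → E d} {f φ : E d → ℝ}

/-- Near a point with a `C^1` chart where `F` is bounded, the flux is nonnegative: the limit `g` of
`F` at almost every point of `Γ` satisfies `g · ∇Φ ≤ 0`, as `-∇Φ` is an outward normal. -/
theorem fluxNonnegAt_of_boundaryOfClassAt (hd : 0 < d) (hΩ : IsOpen Ω) (hΩb : volume Ω ≠ ⊤)
    (hF : IntegrableOn F Ω) (hf : IntegrableOn f Ω) {D : Set (E d)} (hD : IsClosed D)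
    (hzero : ∀ ψ : E d → ℝ, ContDiff ℝ 1 ψ → HasCompactSupport ψ → tsupport ψ ⊆ Ω →
      flux Ω F f ψ = 0)
    (hΓf : Γ ⊆ frontier Ω) (hΓ : ∀ x, x ∉ D → x ∉ Γ → FluxNonnegAt Ω F f x)
    (hnormal : ∀ᵐ x ∂(μH[(d : ℝ) - 1] : Measure (E d)), x ∈ Γ →
      ∃ g : E d, Tendsto F (essNhds Ω x) (𝓝 g) ∧
        ∀ ν : E d, IsOutwardUnitNormal Ω x ν → 0 ≤ inner ℝ ν g)
    {x : E d} (hxD : x ∉ D) (hx : BoundaryOfClassAt 1 Ω x) {M : ℝ}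
    (hM : ∀ᶠ y in essNhds Ω x, ‖F y‖ ≤ M) : FluxNonnegAt Ω F f x := by
  obtain ⟨e, Φ, hΦ, he, hchart⟩ := hx.exists_defining_function
  obtain ⟨r₁, hr₁, hM⟩ := (eventually_essNhds_iff hΩ.measurableSet).1 hM
  obtain ⟨r₂, hr₂, hr⟩ := Metric.eventually_nhds_iff_ball.1
    (hchart.and (hD.isOpen_compl.mem_nhds hxD))
  refine ⟨min r₁ r₂, by positivity, fun φ hφ hs => ?_⟩
  have hV₁ : Metric.ball x (min r₁ r₂) ⊆ Metric.ball x r₁ :=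
    Metric.ball_subset_ball (min_le_left _ _)
  have hV₂ : Metric.ball x (min r₁ r₂) ⊆ Metric.ball x r₂ :=
    Metric.ball_subset_ball (min_le_right _ _)
  set V := Metric.ball x (min r₁ r₂) with hV
  have hVo : IsOpen V := Metric.isOpen_ball
  have hchartV : ∀ y ∈ V, y ∈ Ω ↔ 0 < Φ y := fun y hy => (hr y (hV₂ hy)).1
  refine flux_nonneg_of_chart hd hΩ.measurableSet hΩb hF hf hΦ he hVo hchartV hzero (M := M)
    (hM.mono fun y hy hyV => hy (hV₁ hyV)) ?_ hφ hs
  filter_upwards [hnormal] with y hy hyV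
  by_cases hyΓ : y ∈ Γ
  · right
    obtain ⟨g, hg, hν⟩ := hy hyΓ
    have h0 := eq_zero_of_mem_frontier_of_chart hΩ hVo hΦ.continuous hchartV hyV (hΓf hyΓ)
    have hΦd := (hΦ.differentiable one_ne_zero) y
    have hne : gradient Φ y ≠ 0 := fun h => by
      have := inner_gradient Φ y e
      rw [he, h, inner_zero_left] at this
      exact zero_ne_one this
    have hle : fderiv ℝ Φ y g ≤ 0 := by
      have h1 := hν _ (isOutwardUnitNormal_of_defining_function hΦd h0 hne
        (eventually_of_mem (hVo.mem_nhds hyV) hchartV))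
      rw [inner_neg_left, real_inner_smul_left, inner_gradient, neg_nonneg] at h1
      have h2 : 0 < ‖gradient Φ y‖⁻¹ := inv_pos.2 (norm_pos_iff.2 hne)
      by_contra h3
      exact absurd h1 (not_le.2 (mul_pos h2 (not_le.1 h3)))
    have hlim : Tendsto (fun z => fderiv ℝ Φ z (F z)) (essNhds Ω y) (𝓝 (fderiv ℝ Φ y g)) := by
      have h1 : Tendsto (fun z => fderiv ℝ Φ z) (essNhds Ω y) (𝓝 (fderiv ℝ Φ y)) :=
        ((hΦ.continuous_fderiv one_ne_zero).tendsto y).mono_left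
          (inf_le_left.trans nhdsWithin_le_nhds)
      exact (isBoundedBilinearMap_apply.continuous.tendsto (fderiv ℝ Φ y, g)).comp
        (h1.prodMk_nhds hg)
    intro η hη
    exact (eventually_essNhds_iff hΩ.measurableSet).1
      ((hlim.eventually_lt_const (hle.trans_lt hη)).mono fun z hz => hz.le)
  · exact Or.inl (hΓ y (hr y (hV₂ hyV)).2 hyΓ)

/-- If the normal component of `F` is nonnegative almost everywhere on `Γ`, and no flux is
concentrated on the points of `Γ` near which `F` is unbounded, then the flux is nonnegative. -/
theorem flux_nonneg_of_boundary (hd : 0 < d) (hΩ : IsOpen Ω) (hΩb : volume Ω ≠ ⊤)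
    (hF : IntegrableOn F Ω) (hf : IntegrableOn f Ω) {D : Set (E d)} (hD : IsClosed D)
    (hzero : ∀ ψ : E d → ℝ, ContDiff ℝ 1 ψ → HasCompactSupport ψ → tsupport ψ ⊆ Ω →
      flux Ω F f ψ = 0)
    (hΓf : Γ ⊆ frontier Ω) (hΓ : ∀ x, x ∉ D → x ∉ Γ → FluxNonnegAt Ω F f x)
    (hC1 : ∀ᵐ x ∂(μH[(d : ℝ) - 1] : Measure (E d)), x ∈ Γ → BoundaryOfClassAt 1 Ω x)
    (hnormal : ∀ᵐ x ∂(μH[(d : ℝ) - 1] : Measure (E d)), x ∈ Γ →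
      ∃ g : E d, Tendsto F (essNhds Ω x) (𝓝 g) ∧
        ∀ ν : E d, IsOutwardUnitNormal Ω x ν → 0 ≤ inner ℝ ν g)
    (hflux : ∀ K ⊆ {x ∈ Γ | ¬ ∃ M : ℝ, ∀ᶠ y in essNhds Ω x, ‖F y‖ ≤ M}, IsCompact K →
      ∀ ε > 0, ∃ χ : E d → ℝ, ContDiff ℝ 1 χ ∧ HasCompactSupport χ ∧
        (∀ x, 0 ≤ χ x ∧ χ x ≤ 1) ∧ (∀ᶠ y in 𝓝ˢ K, χ y = 1) ∧
        (∫ x in Ω, (χ x + ‖F x‖ * ‖fderiv ℝ χ x‖)) < ε)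
    (hφ : IsNonnegTest φ) (hφD : Disjoint (tsupport φ) D) : 0 ≤ flux Ω F f φ := by
  have hbdd : ∀ x, x ∉ D → (∃ M : ℝ, ∀ᶠ y in essNhds Ω x, ‖F y‖ ≤ M) →
      FluxNonnegAt Ω F f x := by
    rintro x hxD ⟨M, hM⟩
    obtain ⟨r₁, hr₁, hM⟩ := (eventually_essNhds_iff hΩ.measurableSet).1 hM
    obtain ⟨r₂, hr₂, hr⟩ := Metric.isOpen_iff.1 hD.isOpen_compl x hxD
    refine ⟨min r₁ r₂, by positivity, fun φ hφ hs => ?_⟩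
    have hs₁ := hs.trans (Metric.ball_subset_ball (min_le_left r₁ r₂))
    have hs₂ := hs.trans (Metric.ball_subset_ball (min_le_right r₁ r₂))
    refine flux_nonneg_of_ae_fluxNonnegAt hd hΩ.measurableSet hF hf hφ (M := M)
      (hM.mono fun y hy hyφ => hy (hs₁ hyφ)) ?_
    filter_upwards [hC1] with y hy hyφ
    have hyD : y ∉ D := hr (hs₂ hyφ)
    by_cases hyΓ : y ∈ Γ
    · refine fluxNonnegAt_of_boundaryOfClassAt hd hΩ hΩb hF hf hD hzero hΓf hΓ hnormal hyD
        (hy hyΓ) (M := M) ?_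
      obtain ⟨r, hr0, hrb⟩ := Metric.isOpen_iff.1 Metric.isOpen_ball y (hs₁ hyφ)
      exact (eventually_essNhds_iff hΩ.measurableSet).2
        ⟨r, hr0, hM.mono fun z hz hzr => hz (hrb hzr)⟩
    · exact hΓ y hyD hyΓ
  set K := tsupport φ ∩ {x | FluxNonnegAt Ω F f x}ᶜ with hKdef
  have hK : IsCompact K :=
    hφ.compact.isCompact.inter_right isOpen_setOf_fluxNonnegAt.isClosed_compl
  have hKsub : K ⊆ {x ∈ Γ | ¬ ∃ M : ℝ, ∀ᶠ y in essNhds Ω x, ‖F y‖ ≤ M} := by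
    intro x hx
    have hxD : x ∉ D := disjoint_left.1 hφD hx.1
    refine ⟨?_, fun hM => hx.2 (hbdd x hxD hM)⟩
    by_contra hxΓ
    exact hx.2 (hΓ x hxD hxΓ)
  refine flux_nonneg_of_removable hΩ.measurableSet hF hf hφ (K := K) (fun ε hε => ?_)
    fun x hx hxK => ?_
  · obtain ⟨χ, c1, c2, c3, c4, c5⟩ := hflux K hKsub hK ε hε
    refine ⟨χ, c1, c2, c3, c4, lt_of_le_of_lt ?_ c5⟩
    obtain ⟨C, -, hC⟩ := exists_norm_fderiv_le c1 c2
    have hint : IntegrableOn (fun x => χ x + ‖F x‖ * ‖fderiv ℝ χ x‖) Ω :=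
      (c1.continuous.integrable_of_hasCompactSupport c2).integrableOn.add
        (hF.norm.mul_bdd (c := C) (c1.continuous_fderiv one_ne_zero).norm.aestronglyMeasurable
          (ae_of_all _ fun x => by rw [norm_norm]; exact hC x))
    exact setIntegral_mono_set hint (ae_of_all _ fun x => add_nonneg (c3 x).1 (by positivity))
      inter_subset_left.eventuallyLE
  · by_contra hn
    exact hxK ⟨hx, hn⟩

end Boundary

/-! ### The field of an eigenfunction -/

section PowMap

variable {V : Type*} [NormedAddCommGroup V] [NormedSpace ℝ V]

/-- The map `v ↦ |v|^{p-2} v`. -/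
noncomputable def powMap (p : ℝ) (v : V) : V := ‖v‖ ^ (p - 2) • v

theorem norm_powMap {p : ℝ} (hp : 1 < p) (v : V) : ‖powMap p v‖ = ‖v‖ ^ (p - 1) := by
  rw [powMap, norm_smul, Real.norm_of_nonneg (by positivity)]
  rcases eq_or_ne v 0 with rfl | hv
  · rw [norm_zero, mul_zero, Real.zero_rpow (by linarith)]
  · rw [← Real.rpow_add_one (norm_ne_zero_iff.2 hv)]
    congr 1
    ring

theorem continuous_powMap {p : ℝ} (hp : 1 < p) : Continuous (powMap p : V → V) := by
  rw [continuous_iff_continuousAt]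
  intro v
  rcases eq_or_ne v 0 with rfl | hv
  · have h0 : powMap p (0 : V) = 0 := by simp [powMap]
    rw [ContinuousAt, h0, tendsto_zero_iff_norm_tendsto_zero]
    simp_rw [norm_powMap hp]
    have h1 : Tendsto (fun v : V => ‖v‖ ^ (p - 1)) (𝓝 0) (𝓝 (‖(0 : V)‖ ^ (p - 1))) :=
      (continuous_norm.rpow_const fun _ => Or.inr (by linarith)).tendsto 0
    rwa [norm_zero, Real.zero_rpow (by linarith)] at h1
  · exact (continuousAt_id.norm.rpow_const (Or.inl (norm_ne_zero_iff.2 hv))).smul continuousAt_id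

theorem integrable_powMap {α : Type*} [MeasurableSpace α] {μ : Measure α} [IsFiniteMeasure μ]
    {p : ℝ} (hp : 1 < p) {g : α → V} (hg : MemLp g (ENNReal.ofReal p) μ) :
    Integrable (fun x => powMap p (g x)) μ := by
  have hi := hg.integrable_norm_rpow (by simpa using (by linarith : (0 : ℝ) < p))
    ENNReal.ofReal_ne_top
  rw [ENNReal.toReal_ofReal (by linarith)] at hi
  refine Integrable.mono' ((integrable_const 1).add hi)
    ((continuous_powMap hp).comp_aestronglyMeasurable hg.aestronglyMeasurable)
    (ae_of_all _ fun x => ?_)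
  rw [norm_powMap hp, Pi.add_apply]
  rcases le_total ‖g x‖ 1 with h | h
  · exact (Real.rpow_le_one (norm_nonneg _) h (by linarith)).trans
      (le_add_of_nonneg_right (by positivity))
  · exact (Real.rpow_le_rpow_of_exponent_le h (by linarith)).trans
      (le_add_of_nonneg_left zero_le_one)

end PowMap

section Eigenfunction

variable {d : ℕ} {Ω ΩD Υ ΥD : Set (E d)} {p : ℝ} {u : E d → ℝ} {Du : E d → E d}

/-- In dimension `0` the boundary is empty, and its Dirichlet part has measure zero. -/
theorem IsRegularDomain.dim_pos (hΩ : IsRegularDomain Ω ΩD) : 0 < d := by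
  rcases Nat.eq_zero_or_pos d with rfl | h
  · exfalso
    have hne : ΩD.Nonempty := by
      by_contra h
      have := hΩ.dirichlet_pos
      rw [not_nonempty_iff_eq_empty.1 h, measure_empty] at this
      exact lt_irrefl _ this
    obtain ⟨x, hx⟩ := hne
    obtain ⟨y, hy⟩ := hΩ.isConnected.nonempty
    have := hΩ.dirichlet_subset hx
    rw [hΩ.isOpen.frontier_eq] at this
    exact this.2 (Subsingleton.elim y x ▸ hy)
  · exact h

/-- An eigenfunction has no flux where `Ω` and `Υ` agree away from the Dirichlet boundary. -/
theorem IsFundamentalEigenfunction.flux_eq_zero (hp : 1 < p) (hΥ : IsRegularDomain Υ ΥD)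
    (hsub : Ω ⊆ Υ) (hu : IsFundamentalEigenfunction Υ ΥD p u Du) {W : Set (E d)}
    (hW : IsOpen W) (hWΩ : W ∩ Ω = W ∩ Υ) (hWD : Disjoint W ΥD) {φ : E d → ℝ}
    (hφ : ContDiff ℝ 1 φ) (hc : HasCompactSupport φ) (hs : tsupport φ ⊆ W) :
    flux Ω (fun x => powMap p (Du x)) (fun x => lambda1 Υ ΥD p * powMap p (u x)) φ = 0 := by
  have : IsFiniteMeasure (volume.restrict Υ) := ⟨by
    rw [Measure.restrict_apply_univ]; exact hΥ.isBounded.measure_lt_top⟩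
  have hF : IntegrableOn (fun x => powMap p (Du x)) Υ :=
    integrable_powMap hp hu.sobolev.memLp_grad
  have hf : IntegrableOn (fun x => lambda1 Υ ΥD p * powMap p (u x)) Υ :=
    (integrable_powMap hp hu.sobolev.memLp).const_mul _
  set F := fun x => powMap p (Du x) with hFdef
  set f := fun x => lambda1 Υ ΥD p * powMap p (u x) with hfdef
  have hsmooth : ∀ ψ : E d → ℝ, ContDiff ℝ ∞ ψ → HasCompactSupport ψ → tsupport ψ ⊆ W →
      flux Ω F f ψ = 0 := by
    intro ψ h1 h2 h3
    have h1' : ContDiff ℝ 1 ψ := h1.of_le (by exact_mod_cast le_top)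
    rw [← flux_eq_of_subset hΥ.isOpen.measurableSet hsub fun x hx hxψ =>
      (hWΩ.symm.subset ⟨h3 hxψ, hx⟩).2]
    have hweak := hu.weak_eq ψ ⟨h1, h2, hWD.mono_left h3⟩
    rw [flux, integral_sub (integrableOn_fderiv_apply hF h1' h2)
      (integrableOn_mul_test hf h1'.continuous h2), sub_eq_zero]
    rw [← integral_const_mul] at hweak
    refine (integral_congr_ae (ae_of_all _ fun x => ?_)).trans
      (hweak.trans (integral_congr_ae (ae_of_all _ fun x => ?_)))
    · simp only [hFdef, powMap, map_smul, smul_eq_mul]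
      rw [real_inner_comm, inner_gradient]
    · simp only [hfdef, powMap, smul_eq_mul, Real.norm_eq_abs]
      ring
  obtain ⟨δ, hδ, hδW⟩ := hc.isCompact.exists_cthickening_subset_open hW hs
  have hF' : IntegrableOn F Ω := hF.mono_set hsub
  have hf' : IntegrableOn f Ω := hf.mono_set hsub
  have hG : IntegrableOn (fun x => ‖F x‖ + ‖f x‖) Ω := hF'.norm.add hf'.norm
  set I := ∫ x in Ω, (‖F x‖ + ‖f x‖) with hI
  have hbound : ∀ ε > 0, ε ≤ δ → |flux Ω F f φ| ≤ ε * I := by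
    intro ε hε hεδ
    obtain ⟨ψ, h1, h2, h3, h4, h5⟩ := exists_smooth_approx hφ hc hε
    have h1' : ContDiff ℝ 1 ψ := h1.of_le (by exact_mod_cast le_top)
    have hz := hsmooth ψ h1 h2 (h3.trans ((Metric.cthickening_mono hεδ _).trans hδW))
    rw [← sub_zero (flux Ω F f φ), ← hz, flux, flux,
      ← integral_sub (integrableOn_flux hF' hf' hφ hc) (integrableOn_flux hF' hf' h1' h2),
      hI, ← integral_const_mul, ← Real.norm_eq_abs]
    refine norm_integral_le_of_norm_le (hG.const_mul ε) (ae_of_all _ fun x => ?_)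
    have e1 : ‖fderiv ℝ ψ x (F x) - fderiv ℝ φ x (F x)‖ ≤ ε * ‖F x‖ := by
      rw [← sub_apply]
      exact (ContinuousLinearMap.le_opNorm _ _).trans (by gcongr; exact h5 x)
    have e2 : ‖f x * (ψ x - φ x)‖ ≤ ε * ‖f x‖ := by
      rw [norm_mul, mul_comm]
      gcongr
      exact h4 x
    calc ‖(fderiv ℝ φ x (F x) - f x * φ x) - (fderiv ℝ ψ x (F x) - f x * ψ x)‖
        = ‖f x * (ψ x - φ x) - (fderiv ℝ ψ x (F x) - fderiv ℝ φ x (F x))‖ := by congr 1; ring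
      _ ≤ ε * ‖f x‖ + ε * ‖F x‖ := (norm_sub_le _ _).trans (add_le_add e2 e1)
      _ = ε * (‖F x‖ + ‖f x‖) := by ring
  have hlim : Tendsto (fun ε : ℝ => ε * I) (𝓝[>] 0) (𝓝 (0 * I)) :=
    ((continuous_id.mul continuous_const).tendsto 0).mono_left nhdsWithin_le_nhds
  rw [zero_mul] at hlim
  refine abs_nonpos_iff.1 (ge_of_tendsto hlim ?_)
  filter_upwards [self_mem_nhdsWithin, nhdsWithin_le_nhds (eventually_le_nhds hδ)] with ε h1 h2
  exact hbound ε h1 h2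

/-- An eigenfunction of `Υ` that satisfies the boundary conditions is a supersolution on `Ω`, in the
sense that includes the boundary `frontier Ω \ ΩD`. -/
theorem IsFundamentalEigenfunction.flux_nonneg (hp : 1 < p)
    (hΩ : IsRegularDomain Ω ΩD) (hΥ : IsRegularDomain Υ ΥD) (hsub : Ω ⊆ Υ)
    (hu : IsFundamentalEigenfunction Υ ΥD p u Du)
    (hnormal : NormalDerivNonneg Ω ((frontier Ω \ ΩD) \ sharedNatural Ω Υ ΥD) Du)
    (hflux : CarriesNoFlux Ω p Du
      (unboundedPoints Ω ((frontier Ω \ ΩD) \ sharedNatural Ω Υ ΥD) Du))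
    {φ : E d → ℝ} (hφ : IsNonnegTest φ) (hφD : Disjoint (tsupport φ) ΩD) :
    0 ≤ flux Ω (fun x => powMap p (Du x)) (fun x => lambda1 Υ ΥD p * powMap p (u x)) φ := by
  have : IsFiniteMeasure (volume.restrict Υ) := ⟨by
    rw [Measure.restrict_apply_univ]; exact hΥ.isBounded.measure_lt_top⟩
  have hF : IntegrableOn (fun x => powMap p (Du x)) Ω :=
    IntegrableOn.mono_set (integrable_powMap hp hu.sobolev.memLp_grad) hsub
  have hf : IntegrableOn (fun x => lambda1 Υ ΥD p * powMap p (u x)) Ω :=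
    IntegrableOn.mono_set ((integrable_powMap hp hu.sobolev.memLp).const_mul _) hsub
  have hΩΥD : Disjoint Ω ΥD := disjoint_left.2 fun x hx hxD => by
    have := hΥ.dirichlet_subset hxD
    rw [hΥ.isOpen.frontier_eq] at this
    exact this.2 (hsub hx)
  have hzero : ∀ ψ : E d → ℝ, ContDiff ℝ 1 ψ → HasCompactSupport ψ → tsupport ψ ⊆ Ω →
      flux Ω (fun x => powMap p (Du x)) (fun x => lambda1 Υ ΥD p * powMap p (u x)) ψ = 0 :=
    fun ψ h1 h2 h3 => hu.flux_eq_zero hp hΥ hsub hΩ.isOpen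
      (by rw [inter_self, inter_eq_left.2 hsub]) hΩΥD h1 h2 h3
  refine flux_nonneg_of_boundary (Γ := (frontier Ω \ ΩD) \ sharedNatural Ω Υ ΥD) hΩ.dim_pos
    hΩ.isOpen hΩ.isBounded.measure_lt_top.ne hF hf hΩ.isClosed_dirichlet hzero
    (sdiff_subset.trans sdiff_subset) (fun x hxD hxΓ => ?_) ?_ ?_ ?_ hφ hφD
  · by_cases hxs : x ∈ sharedNatural Ω Υ ΥD
    · obtain ⟨U, hU, hUΩ, hUD⟩ := hxs
      obtain ⟨r, hr, hrU⟩ := Metric.mem_nhds_iff.1 hU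
      refine ⟨r, hr, fun ψ hψ hs => ?_⟩
      refine (hu.flux_eq_zero hp hΥ hsub Metric.isOpen_ball ?_ (hUD.mono_left hrU)
        hψ.contDiff hψ.compact hs).ge
      ext y
      exact and_congr_right fun hy =>
        ⟨fun h => hsub h, fun h => (hUΩ.symm.subset ⟨hrU hy, h⟩).2⟩
    · by_cases hxΩ : x ∈ Ω
      · obtain ⟨r, hr, hrΩ⟩ := Metric.isOpen_iff.1 hΩ.isOpen x hxΩ
        exact ⟨r, hr, fun ψ hψ hs => (hzero ψ hψ.contDiff hψ.compact (hs.trans hrΩ)).ge⟩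
      · have hxc : x ∉ closure Ω := fun h =>
          hxΓ ⟨⟨hΩ.isOpen.frontier_eq.symm.subset ⟨h, hxΩ⟩, hxD⟩, hxs⟩
        obtain ⟨r, hr, hrΩ⟩ := Metric.isOpen_iff.1 isClosed_closure.isOpen_compl x hxc
        exact ⟨r, hr, fun ψ hψ hs => (flux_eq_zero_of_disjoint
          (disjoint_left.2 fun y hy hyΩ => hrΩ (hs hy) (subset_closure hyΩ))).ge⟩
  · filter_upwards [hΩ.ae_C1] with x hx hxΓ
    exact hx hxΓ.1
  · filter_upwards [hnormal] with x hx hxΓ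
    obtain ⟨g, hg, hν⟩ := hx hxΓ
    refine ⟨powMap p g, ((continuous_powMap hp).tendsto g).comp hg, fun ν h => ?_⟩
    rw [powMap, real_inner_smul_right]
    exact mul_nonneg (by positivity) (hν ν h)
  · intro K hK hKc ε hε
    have hKsub : K ⊆ unboundedPoints Ω ((frontier Ω \ ΩD) \ sharedNatural Ω Υ ΥD) Du := by
      intro x hx
      refine ⟨(hK hx).1, fun ⟨M, hM⟩ => (hK hx).2 ⟨M ^ (p - 1), ?_⟩⟩
      filter_upwards [eventually_map.1 hM] with y hy
      rw [norm_powMap hp]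
      exact Real.rpow_le_rpow (norm_nonneg _) hy (by linarith)
    obtain ⟨χ, c1, c2, c3, c4, c5⟩ := hflux K hKsub hKc ε hε
    refine ⟨χ, c1.of_le (by exact_mod_cast le_top), c2, c3, c4, ?_⟩
    simpa only [norm_powMap hp, norm_gradient] using c5

end Eigenfunction

/-! ### Picone's inequality -/

theorem young_mul_rpow_le {p : ℝ} (hp : 1 < p) {a b : ℝ} (ha : 0 ≤ a) (hb : 0 ≤ b) :
    p * (a ^ (p - 1) * b) ≤ (p - 1) * a ^ p + b ^ p := by
  have hpq := Real.HolderConjugate.conjExponent hp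
  have h := Real.young_inequality_of_nonneg hb (Real.rpow_nonneg ha (p - 1)) hpq
  have hp1 : p - 1 ≠ 0 := by linarith
  have hp0 : p ≠ 0 := by linarith
  rw [← Real.rpow_mul ha, Real.conjExponent,
    show (p - 1) * (p / (p - 1)) = p by field_simp] at h
  have h2 := mul_le_mul_of_nonneg_left h (by linarith : 0 ≤ p)
  rw [show p * (b ^ p / p + a ^ p / (p / (p - 1))) = (p - 1) * a ^ p + b ^ p by
    field_simp; ring] at h2
  linarith

/-- The pointwise form of Picone's inequality `|∇u|^{p-2} ∇u · ∇(|ζ|^p / w^{p-1}) ≤ |∇ζ|^p` for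
`∇w = ∇u = D`, `ζ = z` and `∇ζ = L`, with the gradient on the left expanded. -/
theorem picone_le {d : ℕ} {p : ℝ} (hp : 1 < p) {w : ℝ} (hw : 0 < w) (z : ℝ) (D : E d)
    (L : E d →L[ℝ] ℝ) :
    p * ‖z‖ ^ (p - 2) * z * w ^ (1 - p) * L (powMap p D) -
      (p - 1) * (‖z‖ ^ p * w ^ (-p)) * inner ℝ D (powMap p D) ≤ ‖L‖ ^ p := by
  have hwi : w ^ (1 - p) = (w⁻¹) ^ (p - 1) := by
    rw [Real.inv_rpow hw.le, ← Real.rpow_neg hw.le]; congr 1; ring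
  have hwi' : w ^ (-p) = (w⁻¹) ^ p := by rw [Real.inv_rpow hw.le, ← Real.rpow_neg hw.le]
  have hw0 : 0 ≤ w⁻¹ := by positivity
  have hD : inner ℝ D (powMap p D) = ‖D‖ ^ p := by
    rw [powMap, real_inner_smul_right, real_inner_self_eq_norm_sq]
    rcases eq_or_ne D 0 with rfl | h
    · simp [Real.zero_rpow (by linarith : p ≠ 0)]
    · rw [← Real.rpow_natCast, ← Real.rpow_add (norm_pos_iff.2 h)]
      congr 1
      push_cast
      ring
  have hL : p * ‖z‖ ^ (p - 2) * z * w ^ (1 - p) * L (powMap p D) ≤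
      p * ((‖z‖ * ‖D‖ * w⁻¹) ^ (p - 1) * ‖L‖) := by
    have h1 : |‖z‖ ^ (p - 2) * z| = ‖z‖ ^ (p - 1) := norm_powMap hp z
    have h2 : |L (powMap p D)| ≤ ‖L‖ * ‖D‖ ^ (p - 1) := by
      rw [← norm_powMap hp]
      exact L.le_opNorm _
    calc p * ‖z‖ ^ (p - 2) * z * w ^ (1 - p) * L (powMap p D)
        = p * (w ^ (1 - p) * ((‖z‖ ^ (p - 2) * z) * L (powMap p D))) := by ring
      _ ≤ p * (w ^ (1 - p) * (‖z‖ ^ (p - 1) * (‖L‖ * ‖D‖ ^ (p - 1)))) := by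
          refine mul_le_mul_of_nonneg_left (mul_le_mul_of_nonneg_left ?_ (by positivity))
            (by linarith)
          refine (le_abs_self _).trans ?_
          rw [abs_mul, h1]
          gcongr
      _ = _ := by
          rw [Real.mul_rpow (by positivity) hw0, Real.mul_rpow (by positivity) (by positivity),
            hwi]
          ring
  have hY := young_mul_rpow_le hp (a := ‖z‖ * ‖D‖ * w⁻¹) (b := ‖L‖) (by positivity) (by positivity)
  have hpow : (‖z‖ * ‖D‖ * w⁻¹) ^ p = ‖z‖ ^ p * w⁻¹ ^ p * ‖D‖ ^ p := by
    rw [Real.mul_rpow (by positivity) hw0, Real.mul_rpow (by positivity) (by positivity)]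
    ring
  rw [hpow] at hY
  rw [hD, hwi']
  linarith

/-- The product of a bounded sequence that converges almost everywhere and a sequence that converges
in `L^1`. -/
theorem tendsto_integral_mul_of_tendsto {α : Type*} [MeasurableSpace α] {μ : Measure α}
    {c : ℕ → α → ℝ} {c₀ : α → ℝ} {g : ℕ → α → ℝ} {g₀ : α → ℝ} {C : ℝ}
    (hc : ∀ n, AEStronglyMeasurable (c n) μ) (hC : ∀ n x, ‖c n x‖ ≤ C)
    (hlim : ∀ᵐ x ∂μ, Tendsto (fun n => c n x) atTop (𝓝 (c₀ x)))
    (hg : ∀ n, Integrable (g n) μ) (hg₀ : Integrable g₀ μ)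
    (hL : Tendsto (fun n => ∫ x, ‖g n x - g₀ x‖ ∂μ) atTop (𝓝 0)) :
    Tendsto (fun n => ∫ x, c n x * g n x ∂μ) atTop (𝓝 (∫ x, c₀ x * g₀ x ∂μ)) := by
  have h1 : Tendsto (fun n => ∫ x, c n x * (g n x - g₀ x) ∂μ) atTop (𝓝 0) := by
    refine squeeze_zero_norm (fun n => ?_) (by simpa using hL.const_mul C)
    rw [← integral_const_mul]
    refine norm_integral_le_of_norm_le (((hg n).sub hg₀).norm.const_mul C)
      (ae_of_all _ fun x => ?_)
    rw [norm_mul]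
    exact mul_le_mul_of_nonneg_right (hC n x) (norm_nonneg _)
  have h2 : Tendsto (fun n => ∫ x, c n x * g₀ x ∂μ) atTop (𝓝 (∫ x, c₀ x * g₀ x ∂μ)) := by
    refine tendsto_integral_of_dominated_convergence (fun x => C * ‖g₀ x‖)
      (fun n => (hc n).mul hg₀.aestronglyMeasurable) (hg₀.norm.const_mul C)
      (fun n => ae_of_all _ fun x => ?_) ?_
    · rw [norm_mul]
      exact mul_le_mul_of_nonneg_right (hC n x) (norm_nonneg _)
    · filter_upwards [hlim] with x hx
      exact hx.mul_const _
  have h3 := h1.add h2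
  rw [zero_add] at h3
  refine h3.congr fun n => ?_
  have hi : Integrable (fun x => c n x * (g n x - g₀ x)) μ :=
    ((hg n).sub hg₀).bdd_mul (hc n) (ae_of_all _ (hC n))
  rw [← integral_add hi (hg₀.bdd_mul (hc n) (ae_of_all _ (hC n)))]
  congr 1 with x
  ring

theorem memLp_powMap {α V : Type*} [MeasurableSpace α] [NormedAddCommGroup V] [NormedSpace ℝ V]
    {μ : Measure α} {p : ℝ} (hp : 1 < p) {g : α → V} (hg : MemLp g (ENNReal.ofReal p) μ) :
    MemLp (fun x => powMap p (g x)) (ENNReal.ofReal p.conjExponent) μ := by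
  have h := hg.norm_rpow_div (ENNReal.ofReal (p - 1))
  rw [← ENNReal.ofReal_div_of_pos (by linarith), ENNReal.toReal_ofReal (by linarith)] at h
  refine h.of_le ((continuous_powMap hp).comp_aestronglyMeasurable hg.aestronglyMeasurable)
    (ae_of_all _ fun x => ?_)
  rw [norm_powMap hp, Real.norm_of_nonneg (by positivity)]

/-- Hölder's inequality, for convergence: `F · G_n → F · G` in `L^1`. -/
theorem tendsto_integral_norm_inner_sub {α V : Type*} [MeasurableSpace α] [NormedAddCommGroup V]
    [InnerProductSpace ℝ V] {μ : Measure α} {p : ℝ} (hp : 1 < p) {F G : α → V} {Gn : ℕ → α → V}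
    (hF : MemLp F (ENNReal.ofReal p.conjExponent) μ)
    (hG : ∀ n, MemLp (fun x => Gn n x - G x) (ENNReal.ofReal p) μ)
    (hlim : Tendsto (fun n => eLpNorm (fun x => Gn n x - G x) (ENNReal.ofReal p) μ) atTop (𝓝 0)) :
    Tendsto (fun n => ∫ x, ‖(inner ℝ (Gn n x) (F x) - inner ℝ (G x) (F x) : ℝ)‖ ∂μ) atTop
      (𝓝 0) := by
  have hpq := Real.HolderConjugate.conjExponent hp
  have h1 := ((ENNReal.tendsto_toReal ENNReal.zero_ne_top).comp hlim).mul_const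
    ((∫ x, ‖F x‖ ^ p.conjExponent ∂μ) ^ (1 / p.conjExponent))
  rw [ENNReal.toReal_zero, zero_mul] at h1
  refine squeeze_zero (fun n => integral_nonneg fun x => norm_nonneg _) (fun n => ?_) h1
  have h2 := integral_mul_norm_le_Lp_mul_Lq hpq (hG n) hF
  have h3 : (eLpNorm (fun x => Gn n x - G x) (ENNReal.ofReal p) μ).toReal =
      (∫ x, ‖Gn n x - G x‖ ^ p ∂μ) ^ (1 / p) := by
    rw [(hG n).eLpNorm_eq_integral_rpow_norm (by simpa using (by linarith : (0 : ℝ) < p))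
      ENNReal.ofReal_ne_top,
      ENNReal.toReal_ofReal (Real.rpow_nonneg (integral_nonneg fun x => by positivity) _),
      ENNReal.toReal_ofReal (by linarith), one_div]
  rw [Function.comp_apply, h3]
  refine le_trans (integral_mono_of_nonneg (ae_of_all _ fun x => norm_nonneg _) ?_
    (ae_of_all _ fun x => ?_)) h2
  · have : Integrable (fun x => ‖Gn n x - G x‖ * ‖F x‖) μ := by
      have : ENNReal.HolderConjugate (ENNReal.ofReal p) (ENNReal.ofReal p.conjExponent) :=
        hpq.ennrealOfReal
      exact (hG n).norm.integrable_mul hF.norm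
    exact this
  · simp only
    rw [← inner_sub_left]
    exact norm_inner_le_norm _ _

/-- Picone's inequality in integral form: test with `|ζ|^p / (u + ε)^{p-1}`. As this is not of class
`C^1`, it is approximated by replacing `u` with `(v n ^ 2 + (n + 1)^{-2})^{1/2}`, where the
functions `v n` are smooth and converge to `u`; since `u > 0`, the derivative of the square root
tends to `1`. -/
theorem integral_picone_le {d : ℕ} {Ω : Set (E d)} (hΩb : volume Ω ≠ ⊤) {p : ℝ} (hp : 1 < p)
    {u : E d → ℝ} {Du : E d → E d} {l : ℝ}
    (hpos : ∀ᵐ x ∂volume.restrict Ω, 0 < u x)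
    (hu : MemLp u (ENNReal.ofReal p) (volume.restrict Ω))
    (hDu : MemLp Du (ENNReal.ofReal p) (volume.restrict Ω)) {v : ℕ → E d → ℝ}
    (hv : ∀ n, ContDiff ℝ 1 (v n)) (hvc : ∀ n, HasCompactSupport (v n))
    (hvu : ∀ᵐ x ∂volume.restrict Ω, Tendsto (fun n => v n x) atTop (𝓝 (u x)))
    (hvDu : Tendsto (fun n => eLpNorm (fun x => gradient (v n) x - Du x) (ENNReal.ofReal p)
      (volume.restrict Ω)) atTop (𝓝 0))
    {ζ : E d → ℝ} (hζ : ContDiff ℝ 1 ζ) (hζc : HasCompactSupport ζ)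
    (hflux : ∀ φ, IsNonnegTest φ → tsupport φ ⊆ tsupport ζ →
      0 ≤ flux Ω (fun x => powMap p (Du x)) (fun x => l * powMap p (u x)) φ)
    {ε : ℝ} (hε : 0 < ε) :
    ∫ x in Ω, (‖ζ x‖ ^ p * (u x + ε) ^ (1 - p)) * (l * powMap p (u x)) ≤
      ∫ x in Ω, ‖fderiv ℝ ζ x‖ ^ p := by
  have hfin : IsFiniteMeasure (volume.restrict Ω) :=
    ⟨by rw [Measure.restrict_apply_univ]; exact hΩb.lt_top⟩
  have hF : IntegrableOn (fun x => powMap p (Du x)) Ω := integrable_powMap hp hDu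
  have hf : IntegrableOn (fun x => l * powMap p (u x)) Ω := (integrable_powMap hp hu).const_mul l
  have hFq := memLp_powMap hp hDu
  set F := fun x => powMap p (Du x) with hFdef
  set f := fun x => l * powMap p (u x) with hfdef
  obtain ⟨M, hM⟩ := hζc.exists_bound_of_continuous hζ.continuous
  have hM0 : 0 ≤ M := (norm_nonneg _).trans (hM 0)
  set δ : ℕ → ℝ := fun n => 1 / ((n : ℝ) + 1) with hδ
  have hδpos : ∀ n, 0 < δ n := fun n => Nat.one_div_pos_of_nat
  have hδlim : Tendsto δ atTop (𝓝 0) := tendsto_one_div_add_atTop_nhds_zero_nat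
  set S : ℕ → E d → ℝ := fun n x => √(v n x ^ 2 + δ n ^ 2) with hS
  have harg : ∀ n x, 0 < v n x ^ 2 + δ n ^ 2 := fun n x => by
    have := hδpos n
    positivity
  have hSpos : ∀ n x, 0 < S n x := fun n x => Real.sqrt_pos.2 (harg n x)
  have hSw : ∀ n x, ε ≤ S n x + ε := fun n x => by linarith [hSpos n x]
  have hS1 : ∀ n, ContDiff ℝ 1 (S n) := fun n =>
    (((hv n).pow 2).add contDiff_const).sqrt fun x => (harg n x).ne'
  have hwpow : ∀ n (s : ℝ), ContDiff ℝ 1 (fun x => (S n x + ε) ^ s) := fun n s =>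
    ((hS1 n).add contDiff_const).rpow_const_of_ne fun x => by linarith [hSw n x]
  have hζp : ContDiff ℝ 1 (fun x => ‖ζ x‖ ^ p) := (contDiff_norm_rpow hp).comp hζ
  have hφ : ∀ n, IsNonnegTest (fun x => ‖ζ x‖ ^ p * (S n x + ε) ^ (1 - p)) := fun n =>
    ⟨hζp.mul (hwpow n _), HasCompactSupport.mul_right (hζc.comp_left (g := fun t : ℝ => ‖t‖ ^ p)
      (by simp [Real.zero_rpow (by linarith : p ≠ 0)])), fun x =>
      mul_nonneg (by positivity) (Real.rpow_nonneg (by linarith [hSw n x]) _)⟩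
  have hsupp : ∀ n, tsupport (fun x => ‖ζ x‖ ^ p * (S n x + ε) ^ (1 - p)) ⊆ tsupport ζ := fun n =>
    closure_mono fun x hx => by
      intro h0
      apply left_ne_zero_of_mul hx
      rw [h0, norm_zero, Real.zero_rpow (by linarith)]
  -- the coefficients of `∇ζ`, `∇(v n)` and `f` in the weak equation
  set a : ℕ → E d → ℝ := fun n x => p * ‖ζ x‖ ^ (p - 2) * ζ x * (S n x + ε) ^ (1 - p) with ha
  set b : ℕ → E d → ℝ := fun n x =>
    (p - 1) * (‖ζ x‖ ^ p * (S n x + ε) ^ (-p)) * (v n x / S n x) with hb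
  set c : ℕ → E d → ℝ := fun n x => ‖ζ x‖ ^ p * (S n x + ε) ^ (1 - p) with hc
  have hderiv : ∀ n x, fderiv ℝ (c n) x (F x) =
      a n x * fderiv ℝ ζ x (F x) - b n x * inner ℝ (gradient (v n) x) (F x) := by
    intro n x
    have h1 : HasFDerivAt (fun x => ‖ζ x‖ ^ p) _ x :=
      (hasDerivAt_norm_rpow (ζ x) hp).comp_hasFDerivAt x
        ((hζ.differentiable one_ne_zero) x).hasFDerivAt
    have h2 : HasFDerivAt (fun x => v n x ^ 2 + δ n ^ 2) _ x :=
      ((((hv n).differentiable one_ne_zero) x).hasFDerivAt.pow 2).add_const (δ n ^ 2)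
    have h3 : HasFDerivAt (fun x => (S n x + ε) ^ (1 - p)) _ x :=
      ((h2.sqrt (harg n x).ne').add_const ε).rpow_const (p := 1 - p)
        (Or.inl (by have := hSw n x; exact (hε.trans_le this).ne'))
    have h4 : HasFDerivAt (c n) _ x := h1.mul h3
    rw [h4.fderiv, inner_gradient]
    simp only [ha, hb, hS, show (1 - p - 1 : ℝ) = -p by ring]
    simp
    have := (hSpos n x).ne'
    simp only [hS] at this
    field_simp
    ring
  have hpow_le : ∀ n x (s : ℝ), s ≤ 0 → ‖(S n x + ε) ^ s‖ ≤ ε ^ s := fun n x s hs => by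
    rw [Real.norm_of_nonneg (Real.rpow_nonneg (by linarith [hSw n x]) _)]
    exact Real.rpow_le_rpow_of_nonpos hε (hSw n x) hs
  have hζpM : ∀ x, ‖‖ζ x‖ ^ p‖ ≤ M ^ p := fun x => by
    rw [Real.norm_of_nonneg (by positivity)]
    exact Real.rpow_le_rpow (norm_nonneg _) (hM x) (by linarith)
  have haC : ∀ n x, ‖a n x‖ ≤ p * M ^ (p - 1) * ε ^ (1 - p) := fun n x => by
    have h1 : ‖‖ζ x‖ ^ (p - 2) * ζ x‖ = ‖ζ x‖ ^ (p - 1) := norm_powMap hp (ζ x)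
    rw [ha]
    simp only
    rw [norm_mul, mul_assoc p, norm_mul p, h1, Real.norm_of_nonneg (by linarith : 0 ≤ p)]
    have := hpow_le n x (1 - p) (by linarith)
    gcongr
    exact hM x
  have hbC : ∀ n x, ‖b n x‖ ≤ (p - 1) * (M ^ p * ε ^ (-p)) * 1 := fun n x => by
    rw [hb]
    simp only
    rw [norm_mul, norm_mul, norm_mul, Real.norm_of_nonneg (by linarith : 0 ≤ p - 1)]
    have h1 := hpow_le n x (-p) (by linarith)
    have h2 : ‖v n x / S n x‖ ≤ 1 := by
      rw [norm_div, Real.norm_of_nonneg (hSpos n x).le, div_le_one (hSpos n x)]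
      exact Real.abs_le_sqrt (by linarith [sq_nonneg (δ n)])
    have h3 := hζpM x
    have hp1 : 0 ≤ p - 1 := by linarith
    gcongr
  have hcC : ∀ n x, ‖c n x‖ ≤ M ^ p * ε ^ (1 - p) := fun n x => by
    rw [hc]
    simp only
    rw [norm_mul]
    exact mul_le_mul (hζpM x) (hpow_le n x _ (by linarith)) (norm_nonneg _) (by positivity)
  have hζcont : Continuous (fun x => p * ‖ζ x‖ ^ (p - 2) * ζ x) := by
    have h1 := (continuous_const (y := p)).mul ((continuous_powMap hp).comp hζ.continuous)
    refine h1.congr fun x => ?_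
    simp [powMap]
    ring
  have ham : ∀ n, AEStronglyMeasurable (a n) (volume.restrict Ω) := fun n =>
    (hζcont.mul (hwpow n _).continuous).aestronglyMeasurable
  have hbm : ∀ n, AEStronglyMeasurable (b n) (volume.restrict Ω) := fun n =>
    ((continuous_const.mul (hζp.continuous.mul (hwpow n _).continuous)).mul
      ((hv n).continuous.div (hS1 n).continuous fun x => (hSpos n x).ne')).aestronglyMeasurable
  have hcm : ∀ n, AEStronglyMeasurable (c n) (volume.restrict Ω) := fun n =>
    (hζp.continuous.mul (hwpow n _).continuous).aestronglyMeasurable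
  have hSlim : ∀ᵐ x ∂volume.restrict Ω, Tendsto (fun n => S n x) atTop (𝓝 (u x)) := by
    filter_upwards [hvu, hpos] with x hx hx0
    have h1 := ((hx.pow 2).add (hδlim.pow 2)).sqrt
    simpa [Real.sqrt_sq hx0.le] using h1
  have hwlim : ∀ (s : ℝ) (x : E d), 0 < u x → Tendsto (fun n => S n x) atTop (𝓝 (u x)) →
      Tendsto (fun n => (S n x + ε) ^ s) atTop (𝓝 ((u x + ε) ^ s)) := fun s x hx0 hx =>
    (hx.add_const ε).rpow_const (Or.inl (by positivity))
  have hg : ∀ n, IntegrableOn (fun x => (inner ℝ (gradient (v n) x) (F x) : ℝ)) Ω := fun n => by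
    simp_rw [inner_gradient]
    exact integrableOn_fderiv_apply hF (hv n) (hvc n)
  have hζF := integrableOn_fderiv_apply hF hζ hζc
  have hpq := Real.HolderConjugate.conjExponent hp
  have hconj : ENNReal.HolderConjugate (ENNReal.ofReal p) (ENNReal.ofReal p.conjExponent) :=
    hpq.ennrealOfReal
  have hDF : IntegrableOn (fun x => (inner ℝ (Du x) (F x) : ℝ)) Ω := by
    refine Integrable.mono' (hDu.norm.integrable_mul hFq.norm)
      (hDu.aestronglyMeasurable.inner hFq.aestronglyMeasurable)
      (ae_of_all _ fun x => norm_inner_le_norm _ _)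
  have hLa := tendsto_integral_mul_of_tendsto (g := fun _ x => fderiv ℝ ζ x (F x))
    (c₀ := fun x => p * ‖ζ x‖ ^ (p - 2) * ζ x * (u x + ε) ^ (1 - p)) ham haC
    (by filter_upwards [hSlim, hpos] with x hx hx0 using (hwlim _ x hx0 hx).const_mul _)
    (fun _ => hζF) hζF (by simp)
  have hLc := tendsto_integral_mul_of_tendsto (g := fun _ => f)
    (c₀ := fun x => ‖ζ x‖ ^ p * (u x + ε) ^ (1 - p)) hcm hcC
    (by filter_upwards [hSlim, hpos] with x hx hx0 using (hwlim _ x hx0 hx).const_mul _)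
    (fun _ => hf) hf (by simp)
  have hLb := tendsto_integral_mul_of_tendsto
    (g := fun n x => (inner ℝ (gradient (v n) x) (F x) : ℝ))
    (c₀ := fun x => (p - 1) * (‖ζ x‖ ^ p * (u x + ε) ^ (-p))) hbm hbC
    (by
      filter_upwards [hSlim, hpos, hvu] with x hx hx0 hxv
      have h1 := (((hwlim (-p) x hx0 hx).const_mul (‖ζ x‖ ^ p)).const_mul (p - 1)).mul
        (hxv.div hx hx0.ne')
      rwa [div_self hx0.ne', mul_one] at h1)
    hg hDF (tendsto_integral_norm_inner_sub hp hFq (fun n => by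
      have h1 : MemLp (gradient (v n)) (ENNReal.ofReal p) (volume.restrict Ω) := by
        have hcont : Continuous (gradient (v n)) :=
          (InnerProductSpace.toDual ℝ (E d)).symm.continuous.comp
            ((hv n).continuous_fderiv one_ne_zero)
        obtain ⟨C, -, hC⟩ := exists_norm_fderiv_le (hv n) (hvc n)
        exact MemLp.of_bound hcont.aestronglyMeasurable C (ae_of_all _ fun x => by
          rw [norm_gradient]; exact hC x)
      exact h1.sub hDu) hvDu)
  have hai := fun n => hζF.bdd_mul (ham n) (ae_of_all _ (haC n))
  have hbi := fun n => (hg n).bdd_mul (hbm n) (ae_of_all _ (hbC n))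
  have hci := fun n => hf.bdd_mul (hcm n) (ae_of_all _ (hcC n))
  have hlim := ge_of_tendsto' ((hLa.sub hLb).sub hLc) (b := 0) fun n => by
    have h1 := hflux _ (hφ n) (hsupp n)
    have habi : Integrable (fun x => a n x * fderiv ℝ ζ x (F x) -
        b n x * inner ℝ (gradient (v n) x) (F x)) (volume.restrict Ω) := (hai n).sub (hbi n)
    rw [← integral_sub (hai n) (hbi n), ← integral_sub habi (hci n)]
    refine h1.trans_eq (integral_congr_ae (ae_of_all _ fun x => ?_))
    simp only
    rw [← hderiv n x, mul_comm (c n x)]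
  have hlow : ∀ (s : ℝ), s ≤ 0 → ∀ᵐ x ∂volume.restrict Ω, ‖(u x + ε) ^ s‖ ≤ ε ^ s := by
    intro s hs
    filter_upwards [hpos] with x hx0
    rw [Real.norm_of_nonneg (by positivity)]
    exact Real.rpow_le_rpow_of_nonpos hε (by linarith) hs
  have hum : ∀ s : ℝ, AEStronglyMeasurable (fun x => (u x + ε) ^ s) (volume.restrict Ω) := fun s =>
    ((hu.aestronglyMeasurable.aemeasurable.add_const ε).pow_const s).aestronglyMeasurable
  have hAi : IntegrableOn (fun x => p * ‖ζ x‖ ^ (p - 2) * ζ x * (u x + ε) ^ (1 - p) *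
      fderiv ℝ ζ x (F x)) Ω := by
    refine hζF.bdd_mul (c := p * M ^ (p - 1) * ε ^ (1 - p))
      (hζcont.aestronglyMeasurable.mul (hum _)) ?_
    filter_upwards [hlow (1 - p) (by linarith)] with x hx
    have h1 : ‖‖ζ x‖ ^ (p - 2) * ζ x‖ = ‖ζ x‖ ^ (p - 1) := norm_powMap hp (ζ x)
    rw [norm_mul, mul_assoc p, norm_mul p, h1, Real.norm_of_nonneg (by linarith : 0 ≤ p)]
    gcongr
    exact hM x
  have hBi : IntegrableOn (fun x => (p - 1) * (‖ζ x‖ ^ p * (u x + ε) ^ (-p)) *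
      inner ℝ (Du x) (F x)) Ω := by
    refine hDF.bdd_mul (c := (p - 1) * (M ^ p * ε ^ (-p)))
      (aestronglyMeasurable_const.mul (hζp.continuous.aestronglyMeasurable.mul (hum _))) ?_
    filter_upwards [hlow (-p) (by linarith)] with x hx
    have h3 := hζpM x
    have hp1 : 0 ≤ p - 1 := by linarith
    rw [norm_mul, norm_mul, Real.norm_of_nonneg (by linarith : 0 ≤ p - 1)]
    gcongr
  rw [← integral_sub hAi hBi, sub_nonneg] at hlim
  refine hlim.trans (integral_mono_ae (hAi.sub hBi) ?_ ?_)
  · have hcont : Continuous (fun x => ‖fderiv ℝ ζ x‖ ^ p) :=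
      (hζ.continuous_fderiv one_ne_zero).norm.rpow_const fun _ => Or.inr (by linarith)
    exact (hcont.integrable_of_hasCompactSupport ((hζc.fderiv ℝ).comp_left
      (g := fun L : E d →L[ℝ] ℝ => ‖L‖ ^ p)
      (by simp [Real.zero_rpow (by linarith : p ≠ 0)]))).integrableOn
  · filter_upwards [hpos] with x hx0
    exact picone_le hp (by linarith) (ζ x) (Du x) (fderiv ℝ ζ x)

/-- The `p`-Dirichlet integral of a test function is bounded below by `l` times its `p`-norm, if
there is a positive supersolution `u` with eigenvalue `l`. -/
theorem mul_integral_le_integral_fderiv {d : ℕ} {Ω : Set (E d)} {p : ℝ} (hp : 1 < p)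
    {u : E d → ℝ} {l : ℝ} (hpos : ∀ᵐ x ∂volume.restrict Ω, 0 < u x)
    (hu : AEStronglyMeasurable u (volume.restrict Ω)) {ζ : E d → ℝ} (hζ : Continuous ζ)
    (hζc : HasCompactSupport ζ) {R : ℝ}
    (h : ∀ ε > 0, ∫ x in Ω, (‖ζ x‖ ^ p * (u x + ε) ^ (1 - p)) * (l * powMap p (u x)) ≤ R) :
    l * ∫ x in Ω, ‖ζ x‖ ^ p ≤ R := by
  have hcont : Continuous (fun x => ‖ζ x‖ ^ p) :=
    hζ.norm.rpow_const fun _ => Or.inr (by linarith)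
  have hint : IntegrableOn (fun x => ‖ζ x‖ ^ p) Ω :=
    (hcont.integrable_of_hasCompactSupport (hζc.comp_left (g := fun t : ℝ => ‖t‖ ^ p)
      (by simp [Real.zero_rpow (by linarith : p ≠ 0)]))).integrableOn
  have hquot : ∀ {t ε : ℝ}, 0 < t → 0 < ε →
      (t + ε) ^ (1 - p) * powMap p t = (t / (t + ε)) ^ (p - 1) := by
    intro t ε ht hε
    rw [Real.div_rpow ht.le (by positivity), div_eq_mul_inv, ← Real.rpow_neg (by positivity),
      neg_sub, mul_comm, powMap, smul_eq_mul, Real.norm_of_nonneg ht.le,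
      ← Real.rpow_add_one ht.ne', show p - 2 + 1 = p - 1 by ring]
  have hlim : Tendsto (fun n : ℕ => ∫ x in Ω, (‖ζ x‖ ^ p *
      (u x + 1 / ((n : ℝ) + 1)) ^ (1 - p)) * (l * powMap p (u x))) atTop
      (𝓝 (∫ x in Ω, l * ‖ζ x‖ ^ p)) := by
    refine tendsto_integral_of_dominated_convergence (fun x => |l| * ‖ζ x‖ ^ p) (fun n => ?_)
      (hint.const_mul _) (fun n => ?_) ?_
    · exact (hcont.aestronglyMeasurable.mul
        ((hu.aemeasurable.add_const _).pow_const _).aestronglyMeasurable).mul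
        (aestronglyMeasurable_const.mul ((continuous_powMap hp).comp_aestronglyMeasurable hu))
    · filter_upwards [hpos] with x hx0
      have hn : (0 : ℝ) < 1 / ((n : ℝ) + 1) := Nat.one_div_pos_of_nat
      rw [show (‖ζ x‖ ^ p * (u x + 1 / ((n : ℝ) + 1)) ^ (1 - p)) * (l * powMap p (u x)) =
        (l * ‖ζ x‖ ^ p) * ((u x + 1 / ((n : ℝ) + 1)) ^ (1 - p) * powMap p (u x)) by ring,
        hquot hx0 hn, norm_mul, norm_mul, Real.norm_of_nonneg (by positivity : 0 ≤ ‖ζ x‖ ^ p)]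
      refine mul_le_of_le_one_right (by positivity) ?_
      rw [Real.norm_of_nonneg (by positivity)]
      refine Real.rpow_le_one (by positivity) ?_ (by linarith)
      rw [div_le_one (by positivity)]
      linarith
    · filter_upwards [hpos] with x hx0
      have h1 : Tendsto (fun n : ℕ => u x / (u x + 1 / ((n : ℝ) + 1))) atTop (𝓝 (u x / (u x + 0))) :=
        tendsto_const_nhds.div (tendsto_const_nhds.add tendsto_one_div_add_atTop_nhds_zero_nat)
          (by linarith)
      rw [add_zero, div_self hx0.ne'] at h1
      have h2 := (h1.rpow_const (p := p - 1) (Or.inl one_ne_zero)).const_mul (l * ‖ζ x‖ ^ p)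
      rw [Real.one_rpow, mul_one] at h2
      refine h2.congr fun n => ?_
      rw [← hquot hx0 Nat.one_div_pos_of_nat]
      ring
  rw [← integral_const_mul]
  exact le_of_tendsto' hlim fun n => h _ Nat.one_div_pos_of_nat

/-! ### The comparison of the eigenvalues -/

theorem IsSobolev.exists_seq {d : ℕ} {Ω Υ D : Set (E d)} {p : ℝ} (hp : 1 < p) {u : E d → ℝ}
    {Du : E d → E d} (hu : IsSobolev Υ D p u Du) (hsub : Ω ⊆ Υ) :
    ∃ v : ℕ → E d → ℝ, (∀ n, IsTest D (v n)) ∧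
      (∀ᵐ x ∂volume.restrict Ω, Tendsto (fun n => v n x) atTop (𝓝 (u x))) ∧
      Tendsto (fun n => eLpNorm (fun x => gradient (v n) x - Du x) (ENNReal.ofReal p)
        (volume.restrict Ω)) atTop (𝓝 0) := by
  obtain ⟨v, h1, h2, h3⟩ := hu.approx
  have hm := tendstoInMeasure_of_tendsto_eLpNorm
    (by simpa using (by linarith : (0 : ℝ) < p) : ENNReal.ofReal p ≠ 0)
    (fun n => (h1 n).smooth.continuous.aestronglyMeasurable) hu.memLp.aestronglyMeasurable h2
  obtain ⟨ns, hns, hae⟩ := hm.exists_seq_tendsto_ae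
  refine ⟨fun n => v (ns n), fun n => h1 _, ae_restrict_of_ae_restrict_of_subset hsub hae, ?_⟩
  exact tendsto_of_tendsto_of_tendsto_of_le_of_le tendsto_const_nhds (h3.comp hns.tendsto_atTop)
    (fun n => zero_le) fun n => eLpNorm_mono_measure _ (Measure.restrict_mono hsub le_rfl)

theorem exists_isTest_ne_zero {d : ℕ} {Ω D : Set (E d)} (hΩ : IsRegularDomain Ω D) :
    ∃ ζ : E d → ℝ, IsTest D ζ ∧ ∃ x ∈ Ω, ζ x ≠ 0 := by
  obtain ⟨x, hx⟩ := hΩ.isConnected.nonempty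
  obtain ⟨ζ, h1, h2, h3, -, h4⟩ := exists_contDiff_tsupport_subset (n := ⊤)
    (hΩ.isOpen.mem_nhds hx)
  refine ⟨ζ, ⟨h3, h2, disjoint_left.2 fun y hy hyD => ?_⟩, x, hx, by rw [h4]; exact one_ne_zero⟩
  have := hΩ.dirichlet_subset hyD
  rw [hΩ.isOpen.frontier_eq] at this
  exact this.2 (h1 hy)

end PLap

theorem mainTheorem4 {d : ℕ} (p : ℝ) (hp : 1 < p)
    (Ω ΩD Υ ΥD : Set (PLap.E d))
    (hΩ : PLap.IsRegularDomain Ω ΩD) (hΥ : PLap.IsRegularDomain Υ ΥD) (hsub : Ω ⊆ Υ)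
    (u : PLap.E d → ℝ) (Du : PLap.E d → PLap.E d)
    (hu : PLap.IsFundamentalEigenfunction Υ ΥD p u Du)
    (hpos : ∀ᵐ x ∂(volume.restrict Ω), 0 < u x)
    (hnormal : PLap.NormalDerivNonneg Ω
      ((frontier Ω \ ΩD) \ PLap.sharedNatural Ω Υ ΥD) Du)
    (hflux : PLap.CarriesNoFlux Ω p Du
      (PLap.unboundedPoints Ω ((frontier Ω \ ΩD) \ PLap.sharedNatural Ω Υ ΥD) Du)) :
    PLap.lambda1 Υ ΥD p ≤ PLap.lambda1 Ω ΩD p := by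
  obtain ⟨ζ₀, hζ₀, hne₀⟩ := PLap.exists_isTest_ne_zero hΩ
  refine le_csInf ⟨_, ζ₀, hζ₀, hne₀, rfl⟩ ?_
  rintro _ ⟨ζ, hζ, ⟨x₀, hx₀, hne⟩, rfl⟩
  have hζ1 : ContDiff ℝ 1 ζ := hζ.smooth.of_le (by exact_mod_cast le_top)
  have hmono : volume.restrict Ω ≤ volume.restrict Υ := Measure.restrict_mono hsub le_rfl
  obtain ⟨v, hv, hvu, hvDu⟩ := hu.sobolev.exists_seq hp hsub
  have key : PLap.lambda1 Υ ΥD p * ∫ x in Ω, ‖ζ x‖ ^ p ≤ ∫ x in Ω, ‖fderiv ℝ ζ x‖ ^ p :=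
    PLap.mul_integral_le_integral_fderiv hp hpos
      (hu.sobolev.memLp.aestronglyMeasurable.mono_measure hmono) hζ1.continuous hζ.compact
      fun ε hε => PLap.integral_picone_le hΩ.isBounded.measure_lt_top.ne hp hpos
        (hu.sobolev.memLp.mono_measure hmono) (hu.sobolev.memLp_grad.mono_measure hmono)
        (fun n => (hv n).smooth.of_le (by exact_mod_cast le_top)) (fun n => (hv n).compact) hvu hvDu
        hζ1 hζ.compact
        (fun φ hφ hs => hu.flux_nonneg hp hΩ hΥ hsub hnormal hflux hφ (hζ.away.mono_left hs)) hε
  have hcont : Continuous (fun x => |ζ x| ^ p) :=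
    hζ1.continuous.abs.rpow_const fun _ => Or.inr (by linarith)
  have hint : IntegrableOn (fun x => |ζ x| ^ p) Ω :=
    (hcont.integrable_of_hasCompactSupport (hζ.compact.comp_left (g := fun t : ℝ => |t| ^ p)
      (by simp [Real.zero_rpow (by linarith : p ≠ 0)]))).integrableOn
  have hpos' : 0 < ∫ x in Ω, |ζ x| ^ p := by
    rw [setIntegral_pos_iff_support_of_nonneg_ae (ae_of_all _ fun x => by positivity) hint]
    refine IsOpen.measure_pos volume ((isOpen_ne_fun hcont continuous_const).inter hΩ.isOpen)
      ⟨x₀, ?_, hx₀⟩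
    exact (Real.rpow_pos_of_pos (abs_pos.2 hne) p).ne'
  rw [le_div_iff₀ hpos']
  simpa only [PLap.norm_gradient, Real.norm_eq_abs] using key
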